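/- Write $[a]=\{1,\dots,\lfloor a\rfloor\}$, and say that a function $C$ of the cooperation rate satisfies $C'(0)=\infty$ if $\lim_{\delta\to0^+}\frac{C(\delta)-C(0)}{\delta}=\infty$. Let $W$ be a memoryless two-user binary-input multiple-access channel (MAC) $p_W(y_W|x_0,x_1)$, with $x_0,x_1\in\{0,1\}$ and finite output alphabet $\mathcal Y_W$. **MAC with cooperation.** For $\kappa\ge 0$, a code of blocklength $n$ and rates $R_0,R_1\ge 0$ for $W$ with a cooperation facilitator of rate $\kappa$ consists of a map $f_{CF}:[2^{nR_0}]\times[2^{nR_1}]\to[2^{n\kappa}]$, encoders $f_i:[2^{nR_i}]\times[2^{n\kappa}]\to\{0,1\}^n$ ($i=0,1$), and a decoder $g:\mathcal Y_W^n\to[2^{nR_0}]\times[2^{nR_1}]$. The messages $m_0,m_1$ are independent and uniform, $K=f_{CF}(m_0,m_1)$ is given to both encoders, and $X_i^n=f_i(m_i,K)$ is sent over $W$. The pair $(R_0,R_1)$ is achievable if there is a sequence of such codes, one for each $n$, whose probability of decoding $(m_0,m_1)$ incorrectly tends to $0$. The sum-capacity $C_{\mathrm{sum}}(\kappa)$ is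 the supremum of $R_0+R_1$ over achievable pairs. **Diamond network.** From $W$ form the following memoryless single-source, single-terminal network with three relays. On input $x\in\{0,1\}$ the broadcast stage draws independent fair bits $Y_0,Y_1,Z$; relay $0$ receives $Y_0$, relay $1$ receives $Y_1$, and relay $2$ receives $Y_2=(x\oplus Y_Z,\,Z)$. In the second stage relays $0,1,2$ send $x_0,x_1\in\{0,1\}$ and $x_2\in\{0,1\}^2$, and the terminal receives $(Y_W,x_2)$, where $Y_W$ is the output of $W$ on $(x_0,x_1)$. A code of blocklength $n$ and rate $R\ge 0$ with cooperation rate $\kappa\ge0$ consists of an encoder $f:[2^{nR}]\to\{0,1\}^n$, a cooperation facilitator which maps the three received blocks $(Y_0^n,Y_1^n,Y_2^n)$ to an index $K\in[2^{n\kappa}]$ given to every relay, relay encoders $X_j^n=f_j(Y_j^n,K)$ ($j=0,1,2$), and a decoder from the terminal's block of $n$ outputs to $[2^{nR}]$. The message is uniform on $[2^{nR}]$; $R$ is achievable if there is a sequence of such codes, one for each $n$, with error probability tending to $0$; and the capacity $C(\kappa)$ is the supremum of the achievable rates. **Claim.** If $C_{\mathrm{sum}}'(0)=\infty$, then $C'(0)=\infty$.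 -/

import Mathlib

open Filter Topology

noncomputable section

/-- `[2^{nR}] = {1, …, ⌊2^{nR}⌋}` has this many elements. -/
def indexSize (n : ℕ) (R : ℝ) : ℕ := ⌊(2 : ℝ) ^ ((n : ℝ) * R)⌋₊

/-- A function `C` of the cooperation rate has infinite slope at zero, `C'(0) = ∞`:
the (right) difference quotient at `0` tends to infinity. -/
def HasInfiniteSlopeAtZero (C : ℝ → ℝ) : Prop :=
  Tendsto (fun δ : ℝ => (C δ - C 0) / δ) (𝓝[>] 0) atTop

/-! ### The two-user MAC with a cooperation facilitator -/

/-- A blocklength-`n` code for a two-user MAC with a cooperation facilitator: the facilitator sees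
both messages and sends one of `K` indices to both encoders. -/
structure MACCode (𝒳₀ 𝒳₁ 𝒴 : Type*) (n M₀ M₁ K : ℕ) where
  cf : Fin M₀ → Fin M₁ → Fin K
  enc₀ : Fin M₀ → Fin K → (Fin n → 𝒳₀)
  enc₁ : Fin M₁ → Fin K → (Fin n → 𝒳₁)
  dec : (Fin n → 𝒴) → Fin M₀ × Fin M₁

/-- Average error probability of a code over the memoryless MAC `W`, the two messages being
independent and uniform. -/
def MACCode.errorProb {𝒳₀ 𝒳₁ 𝒴 : Type*} [Fintype 𝒴] {n M₀ M₁ K : ℕ}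
    (c : MACCode 𝒳₀ 𝒳₁ 𝒴 n M₀ M₁ K) (W : 𝒳₀ → 𝒳₁ → PMF 𝒴) : ℝ :=
  (∑ m₀ : Fin M₀, ∑ m₁ : Fin M₁, ∑ y : Fin n → 𝒴,
    (∏ t : Fin n,
      (W (c.enc₀ m₀ (c.cf m₀ m₁) t) (c.enc₁ m₁ (c.cf m₀ m₁) t) (y t)).toReal) *
      (if c.dec y = (m₀, m₁) then 0 else 1)) / ((M₀ : ℝ) * (M₁ : ℝ))

/-- The rate pair `(R₀, R₁)` is achievable over `W` with cooperation rate `κ`. -/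
def MACAchievable {𝒳₀ 𝒳₁ 𝒴 : Type*} [Fintype 𝒴] (W : 𝒳₀ → 𝒳₁ → PMF 𝒴) (κ R₀ R₁ : ℝ) : Prop :=
  0 ≤ R₀ ∧ 0 ≤ R₁ ∧
    ∃ c : ∀ n : ℕ, MACCode 𝒳₀ 𝒳₁ 𝒴 n (indexSize n R₀) (indexSize n R₁) (indexSize n κ),
      Tendsto (fun n => (c n).errorProb W) atTop (𝓝 0)

/-- The sum-capacity of `W` with cooperation rate `κ`. -/
def macSumCapacity {𝒳₀ 𝒳₁ 𝒴 : Type*} [Fintype 𝒴] (W : 𝒳₀ → 𝒳₁ → PMF 𝒴) (κ : ℝ) : ℝ :=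
  sSup {R : ℝ | ∃ R₀ R₁ : ℝ, MACAchievable W κ R₀ R₁ ∧ R = R₀ + R₁}

/-! ### Three-relay diamond networks with a cooperation facilitator -/

/-- A three-relay diamond network: a broadcast channel `p(y₀, y₁, y₂ | x)` followed by a MAC
`q(y | x₀, x₁, x₂)`. -/
structure DiamondNetwork (𝒳 𝒴₀ 𝒴₁ 𝒴₂ 𝒳₀ 𝒳₁ 𝒳₂ 𝒴 : Type*) where
  bc : 𝒳 → PMF (𝒴₀ × 𝒴₁ × 𝒴₂)
  mac : 𝒳₀ → 𝒳₁ → 𝒳₂ → PMF 𝒴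

/-- A blocklength-`n` code with `M` messages for a three-relay diamond network: the facilitator sees
all three received blocks and sends one of `K` indices to every relay. -/
structure DiamondCode (𝒳 𝒴₀ 𝒴₁ 𝒴₂ 𝒳₀ 𝒳₁ 𝒳₂ 𝒴 : Type*) (n M K : ℕ) where
  enc : Fin M → (Fin n → 𝒳)
  cf : (Fin n → 𝒴₀) → (Fin n → 𝒴₁) → (Fin n → 𝒴₂) → Fin K
  relay₀ : (Fin n → 𝒴₀) → Fin K → (Fin n → 𝒳₀)
  relay₁ : (Fin n → 𝒴₁) → Fin K → (Fin n → 𝒳₁)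
  relay₂ : (Fin n → 𝒴₂) → Fin K → (Fin n → 𝒳₂)
  dec : (Fin n → 𝒴) → Fin M

/-- Error probability `P(M̂ ≠ M)` of a code over the network `D`, both channels being memoryless and
the message being uniform. -/
def DiamondCode.errorProb {𝒳 𝒴₀ 𝒴₁ 𝒴₂ 𝒳₀ 𝒳₁ 𝒳₂ 𝒴 : Type*}
    [Fintype 𝒴₀] [Fintype 𝒴₁] [Fintype 𝒴₂] [Fintype 𝒴] {n M K : ℕ}
    (c : DiamondCode 𝒳 𝒴₀ 𝒴₁ 𝒴₂ 𝒳₀ 𝒳₁ 𝒳₂ 𝒴 n M K)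
    (D : DiamondNetwork 𝒳 𝒴₀ 𝒴₁ 𝒴₂ 𝒳₀ 𝒳₁ 𝒳₂ 𝒴) : ℝ :=
  (∑ m : Fin M, ∑ y₀ : Fin n → 𝒴₀, ∑ y₁ : Fin n → 𝒴₁, ∑ y₂ : Fin n → 𝒴₂,
    (∏ t : Fin n, (D.bc (c.enc m t) (y₀ t, y₁ t, y₂ t)).toReal) *
      ∑ y : Fin n → 𝒴,
        (∏ t : Fin n,
          (D.mac (c.relay₀ y₀ (c.cf y₀ y₁ y₂) t) (c.relay₁ y₁ (c.cf y₀ y₁ y₂) t)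
            (c.relay₂ y₂ (c.cf y₀ y₁ y₂) t) (y t)).toReal) *
          (if c.dec y = m then 0 else 1)) / (M : ℝ)

/-- The rate `R` is achievable over `D` with cooperation rate `κ`. -/
def DiamondAchievable {𝒳 𝒴₀ 𝒴₁ 𝒴₂ 𝒳₀ 𝒳₁ 𝒳₂ 𝒴 : Type*}
    [Fintype 𝒴₀] [Fintype 𝒴₁] [Fintype 𝒴₂] [Fintype 𝒴]
    (D : DiamondNetwork 𝒳 𝒴₀ 𝒴₁ 𝒴₂ 𝒳₀ 𝒳₁ 𝒳₂ 𝒴) (κ R : ℝ) : Prop :=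
  0 ≤ R ∧
    ∃ c : ∀ n : ℕ, DiamondCode 𝒳 𝒴₀ 𝒴₁ 𝒴₂ 𝒳₀ 𝒳₁ 𝒳₂ 𝒴 n (indexSize n R) (indexSize n κ),
      Tendsto (fun n => (c n).errorProb D) atTop (𝓝 0)

/-- The capacity of `D` with cooperation rate `κ`. -/
def diamondCapacity {𝒳 𝒴₀ 𝒴₁ 𝒴₂ 𝒳₀ 𝒳₁ 𝒳₂ 𝒴 : Type*}
    [Fintype 𝒴₀] [Fintype 𝒴₁] [Fintype 𝒴₂] [Fintype 𝒴]
    (D : DiamondNetwork 𝒳 𝒴₀ 𝒴₁ 𝒴₂ 𝒳₀ 𝒳₁ 𝒳₂ 𝒴) (κ : ℝ) : ℝ :=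
  sSup {R : ℝ | DiamondAchievable D κ R}

/-- The three-relay network built from a binary-input MAC `W`. On input `x`, the broadcast channel
draws independent fair bits `Y₀, Y₁, Z` and outputs `Y₀`, `Y₁` and `Y₂ = (x ⊕ Y_Z, Z)`
(`Z = false` stands for `0` and `Z = true` for `1`); the second stage outputs `(Y_W, x₂)`, where
`Y_W` is the output of `W` on `(x₀, x₁)`. -/
def diamondOfMAC {𝒴W : Type*} (W : Bool → Bool → PMF 𝒴W) :
    DiamondNetwork Bool Bool Bool (Bool × Bool) Bool Bool (Bool × Bool) (𝒴W × (Bool × Bool)) where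
  bc x := (PMF.uniformOfFintype (Bool × Bool × Bool)).map
    fun b => (b.1, b.2.1, (xor x (if b.2.2 then b.2.1 else b.1), b.2.2))
  mac x₀ x₁ x₂ := (W x₀ x₁).map fun y => (y, x₂)

end

/-! The theorem follows from two inequalities: $C_{\mathrm{sum}}(\kappa)\le 2C(\kappa)+2\kappa$ for
$\kappa\ge0$, and $2C(0)\le C_{\mathrm{sum}}(0)$. Subtracting and dividing by $2\delta$, the
difference quotient of $C$ is at least half that of $C_{\mathrm{sum}}$, minus $1$.

Achievability (`macSumCapacity_le`). Relay $i$ uses about $nR_i$ leading bits of $Y_i^n$ as its MAC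
message, the facilitator acts as in the MAC code, and relay $2$ forwards $(x\oplus Y_Z,Z)$ uncoded.
Once the terminal has decoded these prefixes it knows $Y_Z$, hence $x$, at the positions where $Z$
selects a known bit. This is an erasure channel with about $n(R_0+R_1)/2$ unerased positions, and a
random codebook of any smaller rate succeeds. The loss $\kappa$ arises because $R_i$ may reach
$1+\kappa$, whereas a relay holds only $n$ bits (`exists_diamondCode`,
`diamondAchievable_of_macAchievable`).

Converse at $\kappa=0$ (`diamond_correct_mul_log_le`). Fix $z$; let $A$ be the bits of $Y_0^n,Y_1^n$
selected by $z$ and $B$ the others. The terminal sees $A$ masked by the codeword, so Fano bounds the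
message by $I(A;Y_W^n)$. For the complement of $z$ the roles of $A$ and $B$ are exchanged, and
$I(A;Y_W^n)+I(B;Y_W^n)\le I(A,B;Y_W^n)=I(Y_0^n,Y_1^n;Y_W^n)$ by independence. Without cooperation
each relay input depends on its own block alone, so this single-letterizes to at most
$nC_{\mathrm{sum}}(0)$, and averaging over $z$ yields the factor $1/2$. The single-letter step rests
on `mutualInfo_le_macSumCapacity`, proved by random coding with successive decoding. -/

noncomputable section

/-! ### Product weights on finite function spaces -/

theorem sum_pi_prod {ι α : Type*} [Fintype ι] [DecidableEq ι] [Fintype α] (f : ι → α → ℝ) :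
    ∑ c : ι → α, ∏ i, f i (c i) = ∏ i, ∑ a, f i a := by
  rw [Finset.prod_univ_sum, Fintype.piFinset_univ]

theorem sum_pi_prod_eq_one {ι α : Type*} [Fintype ι] [DecidableEq ι] [Fintype α] {p : ι → α → ℝ}
    (hp : ∀ i, ∑ a, p i a = 1) : ∑ c : ι → α, ∏ i, p i (c i) = 1 := by
  simp [sum_pi_prod, hp]

theorem sum_pi_prod_mul_apply {ι α : Type*} [Fintype ι] [DecidableEq ι] [Fintype α]
    {p : ι → α → ℝ} (hp : ∀ i, ∑ a, p i a = 1) (j : ι) (F : α → ℝ) :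
    ∑ c : ι → α, (∏ i, p i (c i)) * F (c j) = ∑ a, p j a * F a := by
  have h (c : ι → α) : (∏ i, p i (c i)) * F (c j)
      = ∏ i, p i (c i) * (if i = j then F (c i) else 1) := by
    rw [Finset.prod_mul_distrib]; simp
  simp only [h]
  rw [sum_pi_prod (fun i a => p i a * if i = j then F a else 1), Fintype.prod_eq_single j]
  · simp
  · intro i hi; simp [hi, hp]

theorem sum_pi_prod_mul_apply_mul_apply {ι α : Type*} [Fintype ι] [DecidableEq ι] [Fintype α]
    {p : ι → α → ℝ} (hp : ∀ i, ∑ a, p i a = 1) {j k : ι} (hjk : j ≠ k) (F G : α → ℝ) :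
    ∑ c : ι → α, (∏ i, p i (c i)) * (F (c j) * G (c k))
      = (∑ a, p j a * F a) * ∑ a, p k a * G a := by
  have h (c : ι → α) : (∏ i, p i (c i)) * (F (c j) * G (c k))
      = ∏ i, p i (c i) * ((if i = j then F (c i) else 1) * (if i = k then G (c i) else 1)) := by
    rw [Finset.prod_mul_distrib, Finset.prod_mul_distrib]; simp
  simp only [h]
  rw [sum_pi_prod (fun i a => p i a * ((if i = j then F a else 1) * if i = k then G a else 1)),
    Fintype.prod_eq_mul j k hjk]
  · simp [hjk, hjk.symm]
  · intro i hi; simp [hi, hp]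

theorem sum_pi_prod_mul_apply₂ {ι α : Type*} [Fintype ι] [DecidableEq ι] [Fintype α]
    {p : ι → α → ℝ} (hp : ∀ i, ∑ a, p i a = 1) {j k : ι} (hjk : j ≠ k) (F : α → α → ℝ) :
    ∑ c : ι → α, (∏ i, p i (c i)) * F (c j) (c k) = ∑ a, p j a * ∑ b, p k b * F a b := by
  classical
  have h (c : ι → α) : (∏ i, p i (c i)) * F (c j) (c k)
      = ∑ b, (∏ i, p i (c i)) * (F (c j) b * if c k = b then 1 else 0) := by
    simp
  simp only [h]
  rw [Finset.sum_comm]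
  simp only [fun b => sum_pi_prod_mul_apply_mul_apply hp hjk (fun a => F a b)
    (fun a => if a = b then 1 else 0)]
  simp only [mul_ite, mul_one, mul_zero, Finset.sum_ite_eq', Finset.mem_univ, if_true,
    Finset.sum_mul, Finset.mul_sum]
  rw [Finset.sum_comm]
  exact Finset.sum_congr rfl fun a _ => Finset.sum_congr rfl fun b _ => by ring

/-- Expanding the square, the cross terms vanish because distinct coordinates are independent and
centred. -/
theorem sum_pi_prod_mul_sum_sq {ι α : Type*} [Fintype ι] [DecidableEq ι] [Fintype α]
    {p : ι → α → ℝ} (hp : ∀ i, ∑ a, p i a = 1) (g : ι → α → ℝ)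
    (hg : ∀ i, ∑ a, p i a * g i a = 0) :
    ∑ c : ι → α, (∏ i, p i (c i)) * (∑ i, g i (c i)) ^ 2 = ∑ i, ∑ a, p i a * g i a ^ 2 := by
  simp only [pow_two, Finset.sum_mul, Finset.mul_sum]
  rw [Finset.sum_comm]
  refine Finset.sum_congr rfl fun j _ => ?_
  rw [Finset.sum_comm, Fintype.sum_eq_single j]
  · exact sum_pi_prod_mul_apply hp j (fun a => g j a * g j a)
  · intro k hk
    rw [sum_pi_prod_mul_apply_mul_apply hp hk (g k) (g j), hg, zero_mul]

open Classical in
/-- Chebyshev's inequality for a sum of independent centred variables. -/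
theorem sum_pi_prod_mul_ite_le {ι α : Type*} [Fintype ι] [DecidableEq ι] [Fintype α]
    {p : ι → α → ℝ} (hp0 : ∀ i a, 0 ≤ p i a) (hp : ∀ i, ∑ a, p i a = 1) (g : ι → α → ℝ)
    (hg : ∀ i, ∑ a, p i a * g i a = 0) {σ : ℝ} (hσ : ∀ i, ∑ a, p i a * g i a ^ 2 ≤ σ)
    {τ : ℝ} (hτ : 0 < τ) :
    ∑ c : ι → α, (∏ i, p i (c i)) * (if ∑ i, g i (c i) ≤ -τ then 1 else 0)
      ≤ Fintype.card ι * σ / τ ^ 2 := by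
  calc _ ≤ ∑ c : ι → α, (∏ i, p i (c i)) * (∑ i, g i (c i)) ^ 2 / τ ^ 2 := by
        refine Finset.sum_le_sum fun c _ => ?_
        rw [mul_div_assoc]
        refine mul_le_mul_of_nonneg_left ?_ (Finset.prod_nonneg fun i _ => hp0 i _)
        split_ifs with h
        · rw [le_div_iff₀ (by positivity)]; nlinarith
        · positivity
    _ = (∑ i, ∑ a, p i a * g i a ^ 2) / τ ^ 2 := by
        rw [← Finset.sum_div, sum_pi_prod_mul_sum_sq hp g hg]
    _ ≤ _ := by
        gcongr
        calc _ ≤ ∑ _i : ι, σ := Finset.sum_le_sum fun i _ => hσ i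
          _ = _ := by simp

/-! ### Averaging, Gibbs' inequality and message counting. -/

/-- The probabilistic method: every random choice of codebooks or shifts below is derandomised
through this averaging. -/
theorem exists_le_of_sum_mul_le {ι : Type*} [Fintype ι] {w f : ι → ℝ} {B : ℝ}
    (hw0 : ∀ i, 0 ≤ w i) (hw : ∑ i, w i = 1) (h : ∑ i, w i * f i ≤ B) : ∃ i, f i ≤ B := by
  by_contra! hB
  have hle : ∑ i, w i * (f i - B) ≤ 0 := by
    simp only [mul_sub, Finset.sum_sub_distrib, ← Finset.sum_mul, hw]; linarith
  have hnn (i : ι) : 0 ≤ w i * (f i - B) := mul_nonneg (hw0 i) (sub_nonneg.2 (hB i).le)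
  have h0 := (Finset.sum_eq_zero_iff_of_nonneg fun i _ => hnn i).1
    (le_antisymm hle (Finset.sum_nonneg fun i _ => hnn i))
  have : ∑ i, w i = 0 := Finset.sum_eq_zero fun i hi =>
    (mul_eq_zero.1 (h0 i hi)).resolve_right (sub_pos.2 (hB i)).ne'
  linarith

/-- Gibbs' inequality in the form used below. -/
theorem sum_mul_log_le {ι : Type*} [Fintype ι] {w h : ι → ℝ} (hw : ∀ i, 0 ≤ w i)
    (hh : ∀ i, 0 < w i → 0 < h i) :
    ∑ i, w i * Real.log (h i) ≤ ∑ i, w i * h i - ∑ i, w i := by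
  rw [← Finset.sum_sub_distrib]
  refine Finset.sum_le_sum fun i _ => ?_
  rcases (hw i).eq_or_lt with h0 | h0
  · simp [← h0]
  · nlinarith [Real.log_le_sub_one_of_pos (hh i h0)]

/-- At most `|ι|` messages can be decoded reliably when the channel input takes values in `ι`. -/
theorem sum_correct_le_card {ι 𝒴 : Type*} [Fintype ι] [Fintype 𝒴] {M : ℕ} (φ : Fin M → ι)
    (V : ι → 𝒴 → ℝ) (hV0 : ∀ i y, 0 ≤ V i y) (hV : ∀ i, ∑ y, V i y = 1) (d : ι → 𝒴 → Fin M) :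
    ∑ m, ∑ y, V (φ m) y * (if d (φ m) y = m then 1 else 0) ≤ Fintype.card ι := by
  classical
  -- Replacing the input `φ m` by a sum over all inputs only adds nonnegative terms; then each pair
  -- `(i, y)` is counted for exactly one message.
  calc _ ≤ ∑ m, ∑ i, ∑ y, V i y * (if d i y = m then 1 else 0) := by
        refine Finset.sum_le_sum fun m _ => ?_
        refine Finset.single_le_sum (f := fun i => ∑ y, V i y * (if d i y = m then 1 else 0))
          (fun i _ => Finset.sum_nonneg fun y _ => mul_nonneg (hV0 _ _) ?_) (Finset.mem_univ (φ m))
        split_ifs <;> simp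
    _ = ∑ i, ∑ y, V i y := by
        rw [Finset.sum_comm]
        refine Finset.sum_congr rfl fun i _ => ?_
        rw [Finset.sum_comm]
        refine Finset.sum_congr rfl fun y _ => ?_
        simp
    _ = _ := by simp [hV]

/-! ### Index sets -/

theorem indexSize_pos (n : ℕ) {R : ℝ} (hR : 0 ≤ R) : 0 < indexSize n R := by
  unfold indexSize
  rw [Nat.floor_pos]
  exact Real.one_le_rpow (by norm_num) (by positivity)

theorem indexSize_zero_right (n : ℕ) : indexSize n 0 = 1 := by simp [indexSize]

theorem indexSize_le (n : ℕ) (R : ℝ) : (indexSize n R : ℝ) ≤ (2 : ℝ) ^ ((n : ℝ) * R) :=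
  Nat.floor_le (by positivity)

theorem rpow_le_two_mul_indexSize (n : ℕ) {R : ℝ} (hR : 0 ≤ R) :
    (2 : ℝ) ^ ((n : ℝ) * R) ≤ 2 * indexSize n R := by
  have h1 := Nat.lt_floor_add_one ((2 : ℝ) ^ ((n : ℝ) * R))
  have h2 : (1 : ℝ) ≤ indexSize n R := by exact_mod_cast indexSize_pos n hR
  unfold indexSize at *
  linarith

/-! ### Channels -/

theorem PMF.sum_toReal {α : Type*} [Fintype α] (p : PMF α) : ∑ a, (p a).toReal = 1 := by
  rw [← ENNReal.toReal_sum fun a _ => p.apply_ne_top a, ← tsum_fintype (L := .unconditional α),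
    p.tsum_coe, ENNReal.toReal_one]

theorem sum_prod_channel {n : ℕ} {𝒴 : Type*} [Fintype 𝒴] (V : Fin n → PMF 𝒴) :
    ∑ y : Fin n → 𝒴, ∏ t, (V t (y t)).toReal = 1 :=
  sum_pi_prod_eq_one (p := fun t b => (V t b).toReal) fun t => (V t).sum_toReal

theorem prod_channel_nonneg {n : ℕ} {𝒴 : Type*} (V : Fin n → PMF 𝒴) (y : Fin n → 𝒴) :
    0 ≤ ∏ t, (V t (y t)).toReal :=
  Finset.prod_nonneg fun _ _ => ENNReal.toReal_nonneg

/-! ### Random coding for the multiple-access channel without cooperation -/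

open Classical in
-- Any pair passing both tests is a good decision. If it is wrong, either its first component is a
-- false alarm for `B`, or the first component is right and the second is a false alarm for `D m₀`;
-- if no pair passes, the true one failed.
theorem exists_decision {M₀ M₁ : ℕ} [NeZero M₀] [NeZero M₁] (B : Fin M₀ → Prop)
    (D : Fin M₀ → Fin M₁ → Prop) :
    ∃ d : Fin M₀ × Fin M₁, ∀ m₀ m₁, (if d = (m₀, m₁) then (0 : ℝ) else 1) ≤
      (if B m₀ ∧ D m₀ m₁ then 0 else 1) + ∑ m ∈ Finset.univ.erase m₀, (if B m then 1 else 0)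
        + ∑ m ∈ Finset.univ.erase m₁, (if D m₀ m then 1 else 0) := by
  have nn₀ (m₀ : Fin M₀) : (0 : ℝ) ≤ ∑ m ∈ Finset.univ.erase m₀, (if B m then 1 else 0) :=
    Finset.sum_nonneg fun m _ => by split_ifs <;> norm_num
  have nn₁ (m₀ : Fin M₀) (m₁ : Fin M₁) :
      (0 : ℝ) ≤ ∑ m ∈ Finset.univ.erase m₁, (if D m₀ m then 1 else 0) :=
    Finset.sum_nonneg fun m _ => by split_ifs <;> norm_num
  by_cases h : ∃ d : Fin M₀ × Fin M₁, B d.1 ∧ D d.1 d.2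
  · obtain ⟨d, hB, hD⟩ := h
    refine ⟨d, fun m₀ m₁ => ?_⟩
    have n0 := nn₀ m₀
    have n1 := nn₁ m₀ m₁
    have n2 : (0 : ℝ) ≤ if B m₀ ∧ D m₀ m₁ then 0 else 1 := by split_ifs <;> norm_num
    split_ifs with hd
    any_goals linarith
    all_goals
      by_cases h0 : d.1 = m₀
      · have h1 : d.2 ≠ m₁ := fun h1 => hd (Prod.ext h0 h1)
        have := Finset.single_le_sum (f := fun m => if D m₀ m then (1 : ℝ) else 0)
          (s := Finset.univ.erase m₁) (fun m _ => by split_ifs <;> norm_num)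
          (Finset.mem_erase.2 ⟨h1, Finset.mem_univ _⟩)
        rw [if_pos (h0 ▸ hD)] at this
        linarith
      · have := Finset.single_le_sum (f := fun m => if B m then (1 : ℝ) else 0)
          (s := Finset.univ.erase m₀) (fun m _ => by split_ifs <;> norm_num)
          (Finset.mem_erase.2 ⟨h0, Finset.mem_univ _⟩)
        rw [if_pos hB] at this
        linarith
  · refine ⟨(0, 0), fun m₀ m₁ => ?_⟩
    rw [if_neg (c := B m₀ ∧ D m₀ m₁) fun hm => h ⟨(m₀, m₁), hm⟩]
    have n0 := nn₀ m₀
    have n1 := nn₁ m₀ m₁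
    split_ifs <;> linarith

theorem sum_mul_sum_mul {α β : Type*} [Fintype α] [Fintype β] (p : α → ℝ) (f : α → β → ℝ)
    (g : β → ℝ) : ∑ x, p x * ∑ y, f x y * g y = ∑ y, (∑ x, p x * f x y) * g y := by
  simp only [Finset.mul_sum, Finset.sum_mul, mul_assoc]
  exact Finset.sum_comm

theorem sum_mul_sum_mul' {α β : Type*} [Fintype α] [Fintype β] (p : α → ℝ) (f : β → ℝ)
    (g : α → β → ℝ) : ∑ x, p x * ∑ y, f y * g x y = ∑ y, f y * ∑ x, p x * g x y := by
  simp only [Finset.mul_sum, mul_left_comm]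
  exact Finset.sum_comm

/-- Markov's inequality, with the division by `a` cleared so that `a = 0` is allowed. It bounds the
chance that an independent codeword passes a likelihood-ratio threshold. -/
theorem sum_mul_ite_lt_le {𝒳 : Type*} [Fintype 𝒳] {P f : 𝒳 → ℝ} (hP : ∀ x, 0 ≤ P x)
    (hf : ∀ x, 0 ≤ f x) {θ a b : ℝ} (hθ : 0 < θ) (hb : ∑ x, P x * f x = b)
    [DecidablePred fun x => θ * a < f x] :
    (∑ x, P x * (if θ * a < f x then 1 else 0)) * a ≤ b / θ := by
  rw [Finset.sum_mul, ← hb, Finset.sum_div]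
  refine Finset.sum_le_sum fun x _ => ?_
  rw [mul_assoc, mul_div_assoc]
  refine mul_le_mul_of_nonneg_left ?_ (hP x)
  split_ifs with h
  · rw [le_div_iff₀ hθ]; linarith
  · rw [zero_mul]; exact div_nonneg (hf x) hθ.le

open Classical in
/-- One-shot achievability for a multiple-access channel by random coding and successive threshold
decoding: `q` is the channel from the first user, `r` the output distribution. -/
theorem exists_mac_codebooks {𝒳₀ 𝒳₁ 𝒴 : Type*} [Fintype 𝒳₀] [Fintype 𝒳₁] [Fintype 𝒴]
    {P₀ : 𝒳₀ → ℝ} {P₁ : 𝒳₁ → ℝ} (hP₀0 : ∀ x, 0 ≤ P₀ x) (hP₀ : ∑ x, P₀ x = 1)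
    (hP₁0 : ∀ x, 0 ≤ P₁ x) (hP₁ : ∑ x, P₁ x = 1) {V : 𝒳₀ → 𝒳₁ → 𝒴 → ℝ}
    (hV0 : ∀ x₀ x₁ y, 0 ≤ V x₀ x₁ y) (hV : ∀ x₀ x₁, ∑ y, V x₀ x₁ y = 1) {q : 𝒳₀ → 𝒴 → ℝ}
    (hq : ∀ x₀ y, ∑ x₁, P₁ x₁ * V x₀ x₁ y = q x₀ y) {r : 𝒴 → ℝ}
    (hr : ∀ y, ∑ x₀, P₀ x₀ * q x₀ y = r y) {θ₀ θ₁ : ℝ} (hθ₀ : 0 < θ₀) (hθ₁ : 0 < θ₁)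
    (M₀ M₁ : ℕ) [NeZero M₀] [NeZero M₁] :
    ∃ (c₀ : Fin M₀ → 𝒳₀) (c₁ : Fin M₁ → 𝒳₁) (dec : 𝒴 → Fin M₀ × Fin M₁),
      (∑ m₀, ∑ m₁, ∑ y, V (c₀ m₀) (c₁ m₁) y * (if dec y = (m₀, m₁) then 0 else 1)) /
          ((M₀ : ℝ) * (M₁ : ℝ)) ≤
        ∑ x₀, P₀ x₀ * ∑ x₁, P₁ x₁ * ∑ y, V x₀ x₁ y *
          (if θ₀ * r y < q x₀ y ∧ θ₁ * q x₀ y < V x₀ x₁ y then 0 else 1)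
        + (M₀ - 1) / θ₀ + (M₁ - 1) / θ₁ := by
  have hq0 (x₀ y) : 0 ≤ q x₀ y := by
    rw [← hq]; exact Finset.sum_nonneg fun x _ => mul_nonneg (hP₁0 x) (hV0 _ _ _)
  have hqs (x₀) : ∑ y, q x₀ y = 1 := by
    simp_rw [← hq]
    rw [Finset.sum_comm]
    simp [← Finset.mul_sum, hV, hP₁]
  have hM₀ : (0 : ℝ) < M₀ := by exact_mod_cast NeZero.pos M₀
  have hM₁ : (0 : ℝ) < M₁ := by exact_mod_cast NeZero.pos M₁
  -- The three error events: `Fa`, the true pair fails a threshold; `Fb`, a wrong first codeword `x`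
  -- passes; `Fc`, a wrong second codeword `x` passes alongside the correct first one.
  set Fa : 𝒳₀ → 𝒳₁ → ℝ := fun x₀ x₁ => ∑ y, V x₀ x₁ y *
    (if θ₀ * r y < q x₀ y ∧ θ₁ * q x₀ y < V x₀ x₁ y then 0 else 1) with hFa
  set Fb : 𝒳₀ → 𝒳₀ → 𝒳₁ → ℝ := fun x₀ x x₁ => ∑ y, V x₀ x₁ y *
    (if θ₀ * r y < q x y then 1 else 0) with hFb
  set Fc : 𝒳₀ → 𝒳₁ → 𝒳₁ → ℝ := fun x₀ x₁ x => ∑ y, V x₀ x₁ y *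
    (if θ₁ * q x₀ y < V x₀ x y then 1 else 0) with hFc
  set S : (Fin M₀ → 𝒳₀) × (Fin M₁ → 𝒳₁) → Fin M₀ → Fin M₁ → ℝ := fun c m₀ m₁ =>
    Fa (c.1 m₀) (c.2 m₁) + ∑ m ∈ Finset.univ.erase m₀, Fb (c.1 m₀) (c.1 m) (c.2 m₁)
      + ∑ m ∈ Finset.univ.erase m₁, Fc (c.1 m₀) (c.2 m₁) (c.2 m) with hS
  set w : (Fin M₀ → 𝒳₀) × (Fin M₁ → 𝒳₁) → ℝ := fun c =>
    (∏ i, P₀ (c.1 i)) * ∏ i, P₁ (c.2 i) with hw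
  -- The wrong codeword is independent of the output, whose law is `r` after averaging over the true
  -- inputs.
  have hb : ∑ x₀, P₀ x₀ * ∑ x, P₀ x * ∑ x₁, P₁ x₁ * Fb x₀ x x₁ ≤ 1 / θ₀ := by
    calc _ = ∑ y, (∑ x, P₀ x * (if θ₀ * r y < q x y then 1 else 0)) * r y := by
          simp only [hFb, sum_mul_sum_mul, hq, fun x₀ => sum_mul_sum_mul' P₀ (q x₀)
            fun x y => if θ₀ * r y < q x y then 1 else 0]
          simp only [hr]
          exact Finset.sum_congr rfl fun y _ => mul_comm _ _
      _ ≤ ∑ y, r y / θ₀ := Finset.sum_le_sum fun y _ =>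
          sum_mul_ite_lt_le hP₀0 (fun x => hq0 x y) hθ₀ (hr y)
      _ = _ := by
          rw [← Finset.sum_div]
          congr 1
          simp_rw [← hr]
          rw [Finset.sum_comm]
          simp [← Finset.mul_sum, hqs, hP₀]
  have hc : ∑ x₀, P₀ x₀ * ∑ x₁, P₁ x₁ * ∑ x, P₁ x * Fc x₀ x₁ x ≤ 1 / θ₁ := by
    calc _ ≤ ∑ x₀, P₀ x₀ * (1 / θ₁) := by
          refine Finset.sum_le_sum fun x₀ _ => mul_le_mul_of_nonneg_left ?_ (hP₀0 x₀)
          calc _ = ∑ y, (∑ x, P₁ x * (if θ₁ * q x₀ y < V x₀ x y then 1 else 0)) * q x₀ y := by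
                simp only [hFc, fun x₁ => sum_mul_sum_mul' P₁ (V x₀ x₁)
                  fun x y => if θ₁ * q x₀ y < V x₀ x y then 1 else 0]
                simp only [sum_mul_sum_mul, hq]
                exact Finset.sum_congr rfl fun y _ => mul_comm _ _
            _ ≤ ∑ y, q x₀ y / θ₁ := Finset.sum_le_sum fun y _ =>
                sum_mul_ite_lt_le hP₁0 (fun x => hV0 x₀ x y) hθ₁ (hq x₀ y)
            _ = _ := by rw [← Finset.sum_div, hqs]
      _ = _ := by rw [← Finset.sum_mul, hP₀, one_mul]
  have hE (m₀ m₁) : ∑ c, w c * S c m₀ m₁ ≤ ∑ x₀, P₀ x₀ * ∑ x₁, P₁ x₁ * Fa x₀ x₁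
        + (M₀ - 1) / θ₀ + (M₁ - 1) / θ₁ := by
    have ea (F : 𝒳₀ → 𝒳₁ → ℝ) : ∑ c, w c * F (c.1 m₀) (c.2 m₁)
        = ∑ x₀, P₀ x₀ * ∑ x₁, P₁ x₁ * F x₀ x₁ := by
      simp only [hw, Fintype.sum_prod_type, mul_assoc, ← Finset.mul_sum]
      simp only [fun x₀ => sum_pi_prod_mul_apply (p := fun _ : Fin M₁ => P₁) (fun _ => hP₁) m₁
        (F x₀)]
      exact sum_pi_prod_mul_apply (p := fun _ : Fin M₀ => P₀) (fun _ => hP₀) m₀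
        (fun x₀ => ∑ x₁, P₁ x₁ * F x₀ x₁)
    have eb {m} (hm : m ∈ Finset.univ.erase m₀) :
        ∑ c, w c * Fb (c.1 m₀) (c.1 m) (c.2 m₁) ≤ 1 / θ₀ := by
      refine le_of_eq_of_le ?_ hb
      simp only [hw, Fintype.sum_prod_type, mul_assoc, ← Finset.mul_sum]
      simp only [fun x₀ x => sum_pi_prod_mul_apply (p := fun _ : Fin M₁ => P₁) (fun _ => hP₁) m₁
        (Fb x₀ x)]
      exact sum_pi_prod_mul_apply₂ (p := fun _ : Fin M₀ => P₀) (fun _ => hP₀)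
        (Finset.ne_of_mem_erase hm).symm (fun x₀ x => ∑ x₁, P₁ x₁ * Fb x₀ x x₁)
    have ec {m} (hm : m ∈ Finset.univ.erase m₁) :
        ∑ c, w c * Fc (c.1 m₀) (c.2 m₁) (c.2 m) ≤ 1 / θ₁ := by
      refine le_of_eq_of_le ?_ hc
      simp only [hw, Fintype.sum_prod_type, mul_assoc, ← Finset.mul_sum]
      simp only [fun x₀ => sum_pi_prod_mul_apply₂ (p := fun _ : Fin M₁ => P₁) (fun _ => hP₁)
        (Finset.ne_of_mem_erase hm).symm (Fc x₀)]
      exact sum_pi_prod_mul_apply (p := fun _ : Fin M₀ => P₀) (fun _ => hP₀) m₀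
        (fun x₀ => ∑ x₁, P₁ x₁ * ∑ x, P₁ x * Fc x₀ x₁ x)
    simp only [hS, mul_add, Finset.sum_add_distrib]
    rw [ea Fa]
    refine add_le_add (add_le_add le_rfl ?_) ?_
    · simp only [Finset.mul_sum]
      rw [Finset.sum_comm]
      refine (Finset.sum_le_sum fun m hm => eb hm).trans (le_of_eq ?_)
      simp [Finset.card_erase_of_mem, Nat.cast_sub (NeZero.one_le : 1 ≤ M₀), div_eq_mul_inv]
    · simp only [Finset.mul_sum]
      rw [Finset.sum_comm]
      refine (Finset.sum_le_sum fun m hm => ec hm).trans (le_of_eq ?_)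
      simp [Finset.card_erase_of_mem, Nat.cast_sub (NeZero.one_le : 1 ≤ M₁), div_eq_mul_inv]
  obtain ⟨c, hc⟩ := exists_le_of_sum_mul_le (w := w)
    (f := fun c => (∑ m₀, ∑ m₁, S c m₀ m₁) / ((M₀ : ℝ) * (M₁ : ℝ)))
    (B := ∑ x₀, P₀ x₀ * ∑ x₁, P₁ x₁ * Fa x₀ x₁ + (M₀ - 1) / θ₀ + (M₁ - 1) / θ₁)
    (fun c => mul_nonneg (Finset.prod_nonneg fun _ _ => hP₀0 _)
      (Finset.prod_nonneg fun _ _ => hP₁0 _))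
    (by
      rw [Fintype.sum_prod_type]
      simp only [hw, ← Finset.mul_sum, ← Finset.sum_mul]
      rw [sum_pi_prod_eq_one (p := fun _ => P₀) fun _ => hP₀,
        sum_pi_prod_eq_one (p := fun _ => P₁) fun _ => hP₁, one_mul])
    (by
      simp_rw [← mul_div_assoc, ← Finset.sum_div]
      rw [div_le_iff₀ (by positivity)]
      simp_rw [Finset.mul_sum]
      rw [Finset.sum_comm]
      simp_rw [Finset.sum_comm (s := (Finset.univ : Finset ((Fin M₀ → 𝒳₀) × (Fin M₁ → 𝒳₁))))]
      refine (Finset.sum_le_sum fun m₀ _ => Finset.sum_le_sum fun m₁ _ => hE m₀ m₁).trans ?_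
      simp only [Finset.sum_const, Finset.card_univ, Fintype.card_fin, nsmul_eq_mul]
      simp only [Finset.mul_sum]
      apply le_of_eq; ring)
  choose dec hdec using fun y => exists_decision (fun m₀ => θ₀ * r y < q (c.1 m₀) y)
    (fun m₀ m₁ => θ₁ * q (c.1 m₀) y < V (c.1 m₀) (c.2 m₁) y)
  refine ⟨c.1, c.2, dec, le_trans ?_ hc⟩
  gcongr with m₀ _ m₁ _
  calc _ ≤ ∑ y, V (c.1 m₀) (c.2 m₁) y * _ :=
        Finset.sum_le_sum fun y _ => mul_le_mul_of_nonneg_left (hdec y m₀ m₁) (hV0 _ _ _)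
    _ = _ := by
        simp only [hS, hFa, hFb, hFc, mul_add, Finset.sum_add_distrib, Finset.mul_sum]
        congr 1
        · congr 1
          exact Finset.sum_comm
        · exact Finset.sum_comm

/-! ### Mutual information and the error exponent of the random code. -/

/-- The mutual information (in nats) between the inputs and the output of a channel with two
independent inputs. -/
def mutualInfo {α β 𝒴 : Type*} [Fintype α] [Fintype β] [Fintype 𝒴] (pa : α → ℝ) (pb : β → ℝ)
    (V : α → β → 𝒴 → ℝ) : ℝ :=
  ∑ a, pa a * ∑ b, pb b * ∑ y, V a b y *
    Real.log (V a b y / ∑ a', pa a' * ∑ b', pb b' * V a' b' y)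

theorem sum_arrow_prod {ι α β : Type*} [Fintype ι] [DecidableEq ι] [Fintype α] [Fintype β]
    (F : (ι → α) → (ι → β) → ℝ) :
    ∑ c : ι → α × β, F (fun i => (c i).1) (fun i => (c i).2) = ∑ x, ∑ y, F x y := by
  rw [← Fintype.sum_prod_type' F, ← (Equiv.arrowProdEquivProdArrow ι (fun _ => α) fun _ => β).sum_comp]
  rfl

open Classical in
/-- Concentration of the normalised log-likelihood ratio. -/
theorem sum_pi_prod_mul_ite_ratio_le {Ω : Type*} [Fintype Ω] {p A B : Ω → ℝ}
    (hp0 : ∀ ω, 0 ≤ p ω) (hp : ∑ ω, p ω = 1) (hA : ∀ ω, 0 < p ω → 0 < A ω)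
    (hB : ∀ ω, 0 < p ω → 0 < B ω) {n : ℕ} (hn : 0 < n) {ε : ℝ} (hε : 0 < ε) {I : ℝ}
    (hI : ∑ ω, p ω * Real.log (A ω / B ω) = I) :
    ∑ c : Fin n → Ω, (∏ t, p (c t)) *
        (if Real.exp (n * (I - ε)) * ∏ t, B (c t) < ∏ t, A (c t) then 0 else 1)
      ≤ (∑ ω, p ω * (Real.log (A ω / B ω) - I) ^ 2) / (n * ε ^ 2) := by
  have hn' : (0 : ℝ) < n := by exact_mod_cast hn
  have key := sum_pi_prod_mul_ite_le (ι := Fin n) (p := fun _ => p) (fun _ => hp0) (fun _ => hp)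
    (fun _ ω => Real.log (A ω / B ω) - I) (fun _ => by
      simp only [mul_sub, Finset.sum_sub_distrib, ← Finset.sum_mul, hp, hI]; ring)
    (fun _ => le_rfl) (τ := n * ε) (by positivity)
  refine le_trans (Finset.sum_le_sum fun c _ => ?_) (key.trans (le_of_eq ?_))
  · rcases (Finset.prod_nonneg fun t _ => hp0 (c t) : 0 ≤ ∏ t, p (c t)).eq_or_lt with h0 | h0
    · simp [← h0]
    refine mul_le_mul_of_nonneg_left ?_ h0.le
    have hpos (t) : 0 < p (c t) := (hp0 _).lt_of_ne fun h =>
      h0.ne' (Finset.prod_eq_zero (Finset.mem_univ t) h.symm)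
    split_ifs with h1 h2 h2
    any_goals norm_num
    apply h2
    have hBp : 0 < ∏ t, B (c t) := Finset.prod_pos fun t _ => hB _ (hpos t)
    have h3 := Real.log_le_log (Finset.prod_pos fun t _ => hA _ (hpos t)) (not_lt.1 h1)
    rw [Real.log_mul (Real.exp_pos _).ne' hBp.ne', Real.log_exp,
      Real.log_prod fun t _ => (hA _ (hpos t)).ne', Real.log_prod fun t _ => (hB _ (hpos t)).ne'] at h3
    have h4 : ∑ t, (Real.log (A (c t) / B (c t)) - I)
        = ∑ t, Real.log (A (c t)) - ∑ t, Real.log (B (c t)) - n * I := by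
      simp only [fun t => Real.log_div (hA _ (hpos t)).ne' (hB _ (hpos t)).ne',
        Finset.sum_sub_distrib]
      simp
    rw [h4]
    linarith
  · simp only [Fintype.card_fin]
    field_simp

/-- A bound on the error probability of the best code without cooperation, for inputs drawn from
auxiliary alphabets `α` and `β`. -/
theorem exists_macCode_errorProb_le {α β 𝒳₀ 𝒳₁ 𝒴 : Type*} [Fintype α] [Fintype β] [Fintype 𝒴]
    {pa : α → ℝ} {pb : β → ℝ} (hpa0 : ∀ a, 0 ≤ pa a) (hpa : ∑ a, pa a = 1)
    (hpb0 : ∀ b, 0 ≤ pb b) (hpb : ∑ b, pb b = 1) (W : 𝒳₀ → 𝒳₁ → PMF 𝒴) (f₀ : α → 𝒳₀)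
    (f₁ : β → 𝒳₁) :
    ∃ I₀ I₁ σ : ℝ, I₀ + I₁ = mutualInfo pa pb (fun a b y => (W (f₀ a) (f₁ b) y).toReal) ∧
      ∀ n : ℕ, 0 < n → ∀ ε : ℝ, 0 < ε → ∀ M₀ M₁ K : ℕ, 0 < M₀ → 0 < M₁ → 0 < K →
        ∃ c : MACCode 𝒳₀ 𝒳₁ 𝒴 n M₀ M₁ K, c.errorProb W ≤ σ / (n * ε ^ 2) +
          (M₀ - 1) / Real.exp (n * (I₀ - ε)) + (M₁ - 1) / Real.exp (n * (I₁ - ε)) := by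
  classical
  set v : α → β → 𝒴 → ℝ := fun a b y => (W (f₀ a) (f₁ b) y).toReal with hv
  have hv0 (a b y) : 0 ≤ v a b y := ENNReal.toReal_nonneg
  have hvs (a b) : ∑ y, v a b y = 1 := PMF.sum_toReal _
  set q : α → 𝒴 → ℝ := fun a y => ∑ b, pb b * v a b y with hq
  set r : 𝒴 → ℝ := fun y => ∑ a, pa a * q a y with hr
  set p : α × β × 𝒴 → ℝ := fun ω => pa ω.1 * (pb ω.2.1 * v ω.1 ω.2.1 ω.2.2) with hp
  have hp0 (ω) : 0 ≤ p ω := mul_nonneg (hpa0 _) (mul_nonneg (hpb0 _) (hv0 _ _ _))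
  have hps : ∑ ω, p ω = 1 := by
    simp only [hp, Fintype.sum_prod_type, ← Finset.mul_sum, hvs, hpb, hpa, mul_one]
  have hvp (ω) (h : 0 < p ω) : 0 < v ω.1 ω.2.1 ω.2.2 :=
    (hv0 _ _ _).lt_of_ne fun h0 => by simp [hp, ← h0] at h
  have hbp (ω) (h : 0 < p ω) : 0 < pb ω.2.1 :=
    (hpb0 _).lt_of_ne fun h0 => by simp [hp, ← h0] at h
  have hap (ω) (h : 0 < p ω) : 0 < pa ω.1 :=
    (hpa0 _).lt_of_ne fun h0 => by simp [hp, ← h0] at h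
  have hqp (ω) (h : 0 < p ω) : 0 < q ω.1 ω.2.2 :=
    (mul_pos (hbp ω h) (hvp ω h)).trans_le (Finset.single_le_sum
      (f := fun b => pb b * v ω.1 b ω.2.2) (fun b _ => mul_nonneg (hpb0 _) (hv0 _ _ _))
      (Finset.mem_univ ω.2.1))
  have hq0 (a y) : 0 ≤ q a y := Finset.sum_nonneg fun b _ => mul_nonneg (hpb0 _) (hv0 _ _ _)
  have hrp (ω) (h : 0 < p ω) : 0 < r ω.2.2 :=
    (mul_pos (hap ω h) (hqp ω h)).trans_le (Finset.single_le_sum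
      (f := fun a => pa a * q a ω.2.2) (fun b _ => mul_nonneg (hpa0 _) (hq0 _ _))
      (Finset.mem_univ ω.1))
  -- These are $I(A;Y)$ and $I(B;Y\mid A)$, a corner point of the rate region. Only the sum matters,
  -- and the chain rule makes it the full mutual information.
  set I₀ := ∑ ω, p ω * Real.log (q ω.1 ω.2.2 / r ω.2.2) with hI₀
  set I₁ := ∑ ω, p ω * Real.log (v ω.1 ω.2.1 ω.2.2 / q ω.1 ω.2.2) with hI₁
  set σ₀ := ∑ ω, p ω * (Real.log (q ω.1 ω.2.2 / r ω.2.2) - I₀) ^ 2 with hσ₀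
  set σ₁ := ∑ ω, p ω * (Real.log (v ω.1 ω.2.1 ω.2.2 / q ω.1 ω.2.2) - I₁) ^ 2 with hσ₁
  refine ⟨I₀, I₁, σ₀ + σ₁, ?_, ?_⟩
  · have : mutualInfo pa pb v
        = ∑ ω : α × β × 𝒴, p ω * Real.log (v ω.1 ω.2.1 ω.2.2 / r ω.2.2) := by
      simp only [mutualInfo, hp, Fintype.sum_prod_type, hr, hq, Finset.mul_sum, mul_assoc]
    rw [this, hI₀, hI₁, ← Finset.sum_add_distrib]
    refine Finset.sum_congr rfl fun ω _ => ?_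
    rcases (hp0 ω).eq_or_lt with h | h
    · simp [← h]
    rw [Real.log_div (hqp ω h).ne' (hrp ω h).ne', Real.log_div (hvp ω h).ne' (hqp ω h).ne',
      Real.log_div (hvp ω h).ne' (hrp ω h).ne']
    ring
  intro n hn ε hε M₀ M₁ K hM₀ hM₁ hK
  have : NeZero M₀ := ⟨hM₀.ne'⟩
  have : NeZero M₁ := ⟨hM₁.ne'⟩
  obtain ⟨c₀, c₁, dec, h⟩ := exists_mac_codebooks
    (P₀ := fun x : Fin n → α => ∏ t, pa (x t)) (P₁ := fun x : Fin n → β => ∏ t, pb (x t))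
    (V := fun x₀ x₁ (y : Fin n → 𝒴) => ∏ t, v (x₀ t) (x₁ t) (y t))
    (q := fun x₀ y => ∏ t, q (x₀ t) (y t)) (r := fun y => ∏ t, r (y t))
    (fun _ => Finset.prod_nonneg fun _ _ => hpa0 _)
    (sum_pi_prod_eq_one (p := fun _ => pa) fun _ => hpa)
    (fun _ => Finset.prod_nonneg fun _ _ => hpb0 _)
    (sum_pi_prod_eq_one (p := fun _ => pb) fun _ => hpb)
    (fun _ _ _ => Finset.prod_nonneg fun _ _ => hv0 _ _ _)
    (fun x₀ x₁ => sum_pi_prod_eq_one (p := fun t => v (x₀ t) (x₁ t)) fun _ => hvs _ _)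
    (fun x₀ y => by
      simp only [← Finset.prod_mul_distrib]
      exact sum_pi_prod fun t b => pb b * v (x₀ t) b (y t))
    (fun y => by
      simp only [← Finset.prod_mul_distrib]
      exact sum_pi_prod fun t a => pa a * q a (y t))
    (Real.exp_pos (n * (I₀ - ε))) (Real.exp_pos (n * (I₁ - ε))) M₀ M₁
  refine ⟨⟨fun _ _ => ⟨0, hK⟩, fun m _ t => f₀ (c₀ m t), fun m _ t => f₁ (c₁ m t), dec⟩, ?_⟩
  refine h.trans ?_
  gcongr
  have e0 := sum_pi_prod_mul_ite_ratio_le hp0 hps hqp hrp hn hε hI₀.symm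
  have e1 := sum_pi_prod_mul_ite_ratio_le hp0 hps hvp hqp hn hε hI₁.symm
  rw [add_div]
  refine le_trans ?_ (add_le_add e0 e1)
  rw [← Finset.sum_add_distrib]
  simp only [hp, Finset.prod_mul_distrib]
  rw [sum_arrow_prod (fun (x : Fin n → α) (z : Fin n → β × 𝒴) =>
    (∏ t, pa (x t)) * ((∏ t, pb (z t).1) * ∏ t, v (x t) (z t).1 (z t).2) *
      (if Real.exp (n * (I₀ - ε)) * ∏ t, r (z t).2 < ∏ t, q (x t) (z t).2 then 0 else 1) +
    (∏ t, pa (x t)) * ((∏ t, pb (z t).1) * ∏ t, v (x t) (z t).1 (z t).2) *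
      (if Real.exp (n * (I₁ - ε)) * ∏ t, q (x t) (z t).2 < ∏ t, v (x t) (z t).1 (z t).2
        then 0 else 1))]
  refine Finset.sum_le_sum fun x₀ _ => ?_
  rw [sum_arrow_prod (fun (x₁ : Fin n → β) (y : Fin n → 𝒴) =>
    (∏ t, pa (x₀ t)) * ((∏ t, pb (x₁ t)) * ∏ t, v (x₀ t) (x₁ t) (y t)) *
      (if Real.exp (n * (I₀ - ε)) * ∏ t, r (y t) < ∏ t, q (x₀ t) (y t) then 0 else 1) +
    (∏ t, pa (x₀ t)) * ((∏ t, pb (x₁ t)) * ∏ t, v (x₀ t) (x₁ t) (y t)) *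
      (if Real.exp (n * (I₁ - ε)) * ∏ t, q (x₀ t) (y t) < ∏ t, v (x₀ t) (x₁ t) (y t)
        then 0 else 1)), Finset.mul_sum]
  refine Finset.sum_le_sum fun x₁ _ => ?_
  rw [Finset.mul_sum, Finset.mul_sum]
  refine Finset.sum_le_sum fun y _ => ?_
  rw [← mul_add, ← mul_assoc, ← mul_assoc, ← mul_assoc]
  refine mul_le_mul_of_nonneg_left ?_ ?_
  · split_ifs <;> first | (exfalso; tauto) | norm_num
  · exact mul_nonneg (mul_nonneg (Finset.prod_nonneg fun _ _ => hpa0 _)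
      (Finset.prod_nonneg fun _ _ => hpb0 _)) (Finset.prod_nonneg fun _ _ => hv0 _ _ _)

/-! ### Counting bounds on the rates -/

theorem tendsto_exp_neg_natCast_mul {ε : ℝ} (hε : 0 < ε) :
    Tendsto (fun n : ℕ => Real.exp (-(n * ε))) atTop (𝓝 0) :=
  Real.tendsto_exp_neg_atTop_nhds_zero.comp
    (tendsto_natCast_atTop_atTop.atTop_mul_const hε)

theorem two_rpow_eq_exp (x : ℝ) : (2 : ℝ) ^ x = Real.exp (x * Real.log 2) := by
  rw [Real.rpow_def_of_pos (by norm_num), mul_comm]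

/-- If $R>\rho$, the success probability is at most $2\cdot2^{-n(R-\rho)}\to0$; the factor $2$ pays
for the floor in `indexSize`. -/
theorem rate_le_of_correct_le {R ρ : ℝ} (hR : 0 ≤ R) {e : ℕ → ℝ} (he : Tendsto e atTop (𝓝 0))
    (h : ∀ n, (1 - e n) * indexSize n R ≤ (2 : ℝ) ^ (n * ρ)) : R ≤ ρ := by
  by_contra! hlt
  have hb (n : ℕ) : 1 - e n ≤ 2 * Real.exp (-(n * ((R - ρ) * Real.log 2))) := by
    have h1 : (0 : ℝ) < indexSize n R := by exact_mod_cast indexSize_pos n hR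
    have h2 := rpow_le_two_mul_indexSize n hR
    rw [two_rpow_eq_exp] at h2
    have h3 := h n
    rw [two_rpow_eq_exp] at h3
    have h4 : Real.exp (n * ρ * Real.log 2)
        = Real.exp (-(n * ((R - ρ) * Real.log 2))) * Real.exp (n * R * Real.log 2) := by
      rw [← Real.exp_add]; ring_nf
    have h5 := Real.exp_pos (-(n * ((R - ρ) * Real.log 2)))
    rw [h4] at h3
    by_contra! h6
    nlinarith
  have h1 := (tendsto_exp_neg_natCast_mul (ε := (R - ρ) * Real.log 2)
    (mul_pos (sub_pos.2 hlt) (Real.log_pos (by norm_num)))).const_mul 2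
  have h2 := le_of_tendsto_of_tendsto' (he.const_sub 1) h1 hb
  norm_num at h2

theorem MACCode.errorProb_nonneg {𝒳₀ 𝒳₁ 𝒴 : Type*} [Fintype 𝒴] {n M₀ M₁ K : ℕ}
    (c : MACCode 𝒳₀ 𝒳₁ 𝒴 n M₀ M₁ K) (W : 𝒳₀ → 𝒳₁ → PMF 𝒴) : 0 ≤ c.errorProb W := by
  refine div_nonneg (Finset.sum_nonneg fun m₀ _ => Finset.sum_nonneg fun m₁ _ =>
    Finset.sum_nonneg fun y _ => mul_nonneg (prod_channel_nonneg (fun t => W _ _) y) ?_)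
    (by positivity)
  split_ifs <;> norm_num

theorem MACCode.correct_mul_eq {𝒳₀ 𝒳₁ 𝒴 : Type*} [Fintype 𝒴] {n M₀ M₁ K : ℕ}
    (hM₀ : 0 < M₀) (hM₁ : 0 < M₁) (c : MACCode 𝒳₀ 𝒳₁ 𝒴 n M₀ M₁ K) (W : 𝒳₀ → 𝒳₁ → PMF 𝒴) :
    (1 - c.errorProb W) * (M₀ * M₁) = ∑ m₀, ∑ m₁, ∑ y : Fin n → 𝒴,
      (∏ t, (W (c.enc₀ m₀ (c.cf m₀ m₁) t) (c.enc₁ m₁ (c.cf m₀ m₁) t) (y t)).toReal) *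
        (if c.dec y = (m₀, m₁) then 1 else 0) := by
  have h0 : (M₀ : ℝ) ≠ 0 := by exact_mod_cast hM₀.ne'
  have h1 : (M₁ : ℝ) ≠ 0 := by exact_mod_cast hM₁.ne'
  rw [sub_mul, one_mul, MACCode.errorProb, div_mul_cancel₀ _ (mul_ne_zero h0 h1), sub_eq_iff_eq_add]
  simp only [← Finset.sum_add_distrib, ← mul_add]
  have h (m₀ m₁) (y : Fin n → 𝒴) : (if c.dec y = (m₀, m₁) then (1 : ℝ) else 0)
      + (if c.dec y = (m₀, m₁) then 0 else 1) = 1 := by split_ifs <;> norm_num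
  simp only [h, mul_one]
  simp only [fun m₀ m₁ => sum_prod_channel fun t =>
    W (c.enc₀ m₀ (c.cf m₀ m₁) t) (c.enc₁ m₁ (c.cf m₀ m₁) t)]
  simp

/-- With the other message fixed, the output law depends on `m₀` only through the pair (codeword,
cooperation index), so `sum_correct_le_card` applies. -/
theorem MACCode.correct_le₀ {𝒳₀ 𝒳₁ 𝒴 : Type*} [Fintype 𝒳₀] [Fintype 𝒴] {n M₀ M₁ K : ℕ}
    (hM₀ : 0 < M₀) (hM₁ : 0 < M₁) (c : MACCode 𝒳₀ 𝒳₁ 𝒴 n M₀ M₁ K) (W : 𝒳₀ → 𝒳₁ → PMF 𝒴) :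
    (1 - c.errorProb W) * M₀ ≤ Fintype.card 𝒳₀ ^ n * K := by
  have h1 : (0 : ℝ) < M₁ := by exact_mod_cast hM₁
  refine le_of_mul_le_mul_right ?_ h1
  rw [mul_assoc, MACCode.correct_mul_eq hM₀ hM₁, Finset.sum_comm]
  calc _ ≤ ∑ m₁ : Fin M₁, (Fintype.card ((Fin n → 𝒳₀) × Fin K) : ℝ) := by
        refine Finset.sum_le_sum fun m₁ _ => le_trans ?_ (sum_correct_le_card
          (fun m₀ => (c.enc₀ m₀ (c.cf m₀ m₁), c.cf m₀ m₁))
          (fun i (y : Fin n → 𝒴) => ∏ t, (W (i.1 t) (c.enc₁ m₁ i.2 t) (y t)).toReal)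
          (fun i => prod_channel_nonneg fun t => W (i.1 t) (c.enc₁ m₁ i.2 t))
          (fun i => sum_prod_channel fun t => W (i.1 t) (c.enc₁ m₁ i.2 t))
          (fun _ y => (c.dec y).1))
        gcongr with m₀ _ y
        split_ifs with h h' <;> simp_all
    _ = _ := by simp; ring

theorem MACCode.correct_le₁ {𝒳₀ 𝒳₁ 𝒴 : Type*} [Fintype 𝒳₁] [Fintype 𝒴] {n M₀ M₁ K : ℕ}
    (hM₀ : 0 < M₀) (hM₁ : 0 < M₁) (c : MACCode 𝒳₀ 𝒳₁ 𝒴 n M₀ M₁ K) (W : 𝒳₀ → 𝒳₁ → PMF 𝒴) :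
    (1 - c.errorProb W) * M₁ ≤ Fintype.card 𝒳₁ ^ n * K := by
  have h1 : (0 : ℝ) < M₀ := by exact_mod_cast hM₀
  refine le_of_mul_le_mul_right ?_ h1
  rw [mul_assoc, mul_comm (M₁ : ℝ), MACCode.correct_mul_eq hM₀ hM₁]
  calc _ ≤ ∑ m₀ : Fin M₀, (Fintype.card ((Fin n → 𝒳₁) × Fin K) : ℝ) := by
        refine Finset.sum_le_sum fun m₀ _ => le_trans ?_ (sum_correct_le_card
          (fun m₁ => (c.enc₁ m₁ (c.cf m₀ m₁), c.cf m₀ m₁))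
          (fun i (y : Fin n → 𝒴) => ∏ t, (W (c.enc₀ m₀ i.2 t) (i.1 t) (y t)).toReal)
          (fun i => prod_channel_nonneg fun t => W (c.enc₀ m₀ i.2 t) (i.1 t))
          (fun i => sum_prod_channel fun t => W (c.enc₀ m₀ i.2 t) (i.1 t))
          (fun _ y => (c.dec y).2))
        gcongr with m₁ _ y
        split_ifs with h h' <;> simp_all
    _ = _ := by simp; ring

theorem two_pow_mul_indexSize_le (n : ℕ) (κ : ℝ) :
    (2 : ℝ) ^ n * indexSize n κ ≤ (2 : ℝ) ^ (n * (1 + κ)) := by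
  rw [mul_add, mul_one, Real.rpow_add (by norm_num), Real.rpow_natCast]
  gcongr
  exact indexSize_le n κ

/-- Serves twice: it makes the supremum defining the sum-capacity a genuine one, and it controls the
truncation of a message to `n` relay bits. -/
theorem MACAchievable.le₀ {𝒴 : Type*} [Fintype 𝒴] {W : Bool → Bool → PMF 𝒴} {κ R₀ R₁ : ℝ}
    (h : MACAchievable W κ R₀ R₁) : R₀ ≤ 1 + κ := by
  obtain ⟨h₀, h₁, c, hc⟩ := h
  refine rate_le_of_correct_le h₀ hc fun n => le_trans ?_ (two_pow_mul_indexSize_le n κ)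
  exact_mod_cast (c n).correct_le₀ (indexSize_pos n h₀) (indexSize_pos n h₁) W

theorem MACAchievable.le₁ {𝒴 : Type*} [Fintype 𝒴] {W : Bool → Bool → PMF 𝒴} {κ R₀ R₁ : ℝ}
    (h : MACAchievable W κ R₀ R₁) : R₁ ≤ 1 + κ := by
  obtain ⟨h₀, h₁, c, hc⟩ := h
  refine rate_le_of_correct_le h₁ hc fun n => le_trans ?_ (two_pow_mul_indexSize_le n κ)
  exact_mod_cast (c n).correct_le₁ (indexSize_pos n h₀) (indexSize_pos n h₁) W

theorem MACAchievable.zero {𝒳₀ 𝒳₁ 𝒴 : Type*} [Nonempty 𝒳₀] [Nonempty 𝒳₁] [Fintype 𝒴]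
    (W : 𝒳₀ → 𝒳₁ → PMF 𝒴) {κ : ℝ} (hκ : 0 ≤ κ) : MACAchievable W κ 0 0 := by
  refine ⟨le_rfl, le_rfl, fun n => ⟨fun _ _ => ⟨0, indexSize_pos n hκ⟩,
    fun _ _ _ => Classical.arbitrary _, fun _ _ _ => Classical.arbitrary _,
    fun _ => (⟨0, indexSize_pos n le_rfl⟩, ⟨0, indexSize_pos n le_rfl⟩)⟩, ?_⟩
  refine tendsto_const_nhds.congr fun n => ?_
  have (a b : Fin (indexSize n 0)) : a = b := by
    rw [indexSize_zero_right] at a b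
    have := indexSize_zero_right n
    ext; omega
  rw [MACCode.errorProb, Finset.sum_eq_zero, zero_div]
  intro a _
  refine Finset.sum_eq_zero fun b _ => Finset.sum_eq_zero fun y _ => ?_
  rw [if_pos (Prod.ext (this _ _) (this _ _)), mul_zero]

theorem bddAbove_mac {𝒴 : Type*} [Fintype 𝒴] (W : Bool → Bool → PMF 𝒴) (κ : ℝ) :
    BddAbove {R : ℝ | ∃ R₀ R₁ : ℝ, MACAchievable W κ R₀ R₁ ∧ R = R₀ + R₁} := by
  refine ⟨(1 + κ) + (1 + κ), ?_⟩
  rintro _ ⟨R₀, R₁, h, rfl⟩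
  exact add_le_add h.le₀ h.le₁

/-! ### The sum-capacity without cooperation -/

/-- Truncating a negative target rate to $0$ leaves one message, and then the numerator is zero.
Otherwise the number of messages is at most $e^{n(J-2\varepsilon)}$, one $\varepsilon$ short of the
threshold. -/
theorem indexSize_sub_one_div_exp_le (n : ℕ) {J ε : ℝ} :
    (indexSize n (max 0 ((J - 2 * ε) / Real.log 2)) - 1 : ℝ) / Real.exp (n * (J - ε))
      ≤ Real.exp (-(n * ε)) := by
  have hl : 0 < Real.log 2 := Real.log_pos (by norm_num)
  rw [div_le_iff₀ (Real.exp_pos _), ← Real.exp_add]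
  rcases le_total ((J - 2 * ε) / Real.log 2) 0 with h | h
  · rw [max_eq_left h, indexSize_zero_right]
    simp [(Real.exp_pos _).le]
  · rw [max_eq_right h]
    have := indexSize_le n ((J - 2 * ε) / Real.log 2)
    rw [two_rpow_eq_exp, mul_assoc, div_mul_cancel₀ _ hl.ne'] at this
    have e : -(n * ε) + n * (J - ε) = n * (J - 2 * ε) := by ring
    rw [e]
    linarith

/-- Random coding at rates just below the corner point. The auxiliary alphabets let the converse
take whole received blocks as inputs, with `f₀` and `f₁` the relays' letters at one time. -/
theorem mutualInfo_le_macSumCapacity {α β 𝒴 : Type*} [Fintype α] [Fintype β] [Fintype 𝒴]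
    {pa : α → ℝ} {pb : β → ℝ} (hpa0 : ∀ a, 0 ≤ pa a) (hpa : ∑ a, pa a = 1)
    (hpb0 : ∀ b, 0 ≤ pb b) (hpb : ∑ b, pb b = 1) (W : Bool → Bool → PMF 𝒴) (f₀ : α → Bool)
    (f₁ : β → Bool) :
    mutualInfo pa pb (fun a b y => (W (f₀ a) (f₁ b) y).toReal)
      ≤ macSumCapacity W 0 * Real.log 2 := by
  have hl : 0 < Real.log 2 := Real.log_pos (by norm_num)
  obtain ⟨I₀, I₁, σ, hI, h⟩ := exists_macCode_errorProb_le hpa0 hpa hpb0 hpb W f₀ f₁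
  rw [← hI]
  refine le_of_forall_pos_le_add fun ε' hε' => ?_
  -- Each of the two rates gives up $2\varepsilon$.
  obtain ⟨ε, hε, rfl⟩ : ∃ ε, 0 < ε ∧ 4 * ε = ε' := ⟨ε' / 4, by positivity, by ring⟩
  set R₀ := max 0 ((I₀ - 2 * ε) / Real.log 2) with hR₀
  set R₁ := max 0 ((I₁ - 2 * ε) / Real.log 2) with hR₁
  have h0 : 0 ≤ R₀ := le_max_left _ _
  have h1 : 0 ≤ R₁ := le_max_left _ _
  have hach : MACAchievable W 0 R₀ R₁ := by
    have hex (n : ℕ) : ∃ c : MACCode Bool Bool 𝒴 n (indexSize n R₀) (indexSize n R₁)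
        (indexSize n 0), 0 < n → c.errorProb W ≤
          σ / (n * ε ^ 2) + Real.exp (-(n * ε)) + Real.exp (-(n * ε)) := by
      rcases Nat.eq_zero_or_pos n with rfl | hn
      · exact ⟨⟨fun _ _ => ⟨0, indexSize_pos _ le_rfl⟩, fun _ _ _ => false, fun _ _ _ => false,
          fun _ => (⟨0, indexSize_pos _ h0⟩, ⟨0, indexSize_pos _ h1⟩)⟩, fun h => absurd h (lt_irrefl 0)⟩
      · obtain ⟨c, hc⟩ := h n hn ε hε _ _ _ (indexSize_pos n h0) (indexSize_pos n h1)
          (indexSize_pos n le_rfl)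
        exact ⟨c, fun _ => hc.trans (add_le_add (add_le_add le_rfl
          (indexSize_sub_one_div_exp_le n)) (indexSize_sub_one_div_exp_le n))⟩
    choose c hc using hex
    refine ⟨h0, h1, c, ?_⟩
    have hlim : Tendsto (fun n : ℕ => σ / (n * ε ^ 2) + Real.exp (-(n * ε)) + Real.exp (-(n * ε)))
        atTop (𝓝 (0 + 0 + 0)) :=
      ((tendsto_const_nhds.div_atTop (tendsto_natCast_atTop_atTop.atTop_mul_const
        (by positivity))).add (tendsto_exp_neg_natCast_mul hε)).add (tendsto_exp_neg_natCast_mul hε)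
    rw [add_zero, add_zero] at hlim
    exact squeeze_zero' (Eventually.of_forall fun n => (c n).errorProb_nonneg W)
      ((eventually_gt_atTop 0).mono fun n hn => hc n hn) hlim
  have hle : R₀ + R₁ ≤ macSumCapacity W 0 := le_csSup (bddAbove_mac W 0) ⟨R₀, R₁, hach, rfl⟩
  have e0 : (I₀ - 2 * ε) / Real.log 2 ≤ R₀ := le_max_right _ _
  have e1 : (I₁ - 2 * ε) / Real.log 2 ≤ R₁ := le_max_right _ _
  rw [div_le_iff₀ hl] at e0 e1
  nlinarith

/-! ### The error probability over the diamond network -/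

/-- The bits `Y_Z`: at each position, `v` if `z` is set and `u` otherwise. -/
def select {n : ℕ} (z u v : Fin n → Bool) (t : Fin n) : Bool := if z t then v t else u t

theorem diamondOfMAC_bc_toReal {𝒴 : Type*} (W : Bool → Bool → PMF 𝒴) (x y₀ y₁ s z : Bool) :
    ((diamondOfMAC W).bc x (y₀, y₁, (s, z))).toReal
      = if s = xor x (if z then y₁ else y₀) then 1 / 8 else 0 := by
  classical
  simp only [diamondOfMAC, PMF.map_apply, PMF.uniformOfFintype_apply, tsum_fintype,
    Fintype.sum_prod_type, Fintype.sum_bool, Fintype.card_prod, Fintype.card_bool, Prod.mk.injEq]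
  cases x <;> cases y₀ <;> cases y₁ <;> cases s <;> cases z <;> norm_num

theorem diamondOfMAC_mac_toReal {𝒴 : Type*} (W : Bool → Bool → PMF 𝒴) (x₀ x₁ : Bool)
    (x₂ x : Bool × Bool) (y : 𝒴) :
    ((diamondOfMAC W).mac x₀ x₁ x₂ (y, x)).toReal = if x = x₂ then (W x₀ x₁ y).toReal else 0 := by
  classical
  simp only [diamondOfMAC, PMF.map_apply, Prod.mk.injEq]
  split_ifs with h
  · simp [h]
  · simp [h]

theorem sum_arrow_prod_ite {n : ℕ} {α β : Type*} [Fintype α] [Fintype β] [DecidableEq β]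
    (f : Fin n → α → ℝ) (b : (Fin n → α) → Fin n → β) (G : (Fin n → α × β) → ℝ) :
    ∑ c : Fin n → α × β, (∏ t, if (c t).2 = b (fun t => (c t).1) t then f t (c t).1 else 0) * G c
      = ∑ x : Fin n → α, (∏ t, f t (x t)) * G fun t => (x t, b x t) := by
  classical
  have := sum_arrow_prod (fun (x : Fin n → α) (y : Fin n → β) =>
    (∏ t, if y t = b x t then f t (x t) else 0) * G fun t => (x t, y t))
  refine Eq.trans this (Finset.sum_congr rfl fun x _ => ?_)
  rw [Fintype.sum_eq_single (b x)]
  · simp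
  · intro y hy
    obtain ⟨t, ht⟩ := Function.ne_iff.1 hy
    rw [Finset.prod_eq_zero (Finset.mem_univ t) (if_neg ht), zero_mul]

/-- Given the message and the three fair words, relay 2's observation and the terminal's copy of
`x₂` are deterministic, so the sums over them collapse and every triple `(u, v, z)` has weight
$8^{-n}$. All later estimates of the error start from this form. -/
theorem diamondCode_errorProb_eq {𝒴 : Type*} [Fintype 𝒴] (W : Bool → Bool → PMF 𝒴) {n M K : ℕ}
    (c : DiamondCode Bool Bool Bool (Bool × Bool) Bool Bool (Bool × Bool) (𝒴 × (Bool × Bool))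
      n M K) (F : Fin M → (Fin n → Bool) → (Fin n → Bool) → (Fin n → Bool) → ℝ)
    (hF : ∀ m u v z, ∀ y₂, y₂ = (fun t => (xor (c.enc m t) (select z u v t), z t)) →
      F m u v z = ∑ y : Fin n → 𝒴,
        (∏ t, (W (c.relay₀ u (c.cf u v y₂) t) (c.relay₁ v (c.cf u v y₂) t) (y t)).toReal) *
          (if c.dec (fun t => (y t, c.relay₂ y₂ (c.cf u v y₂) t)) = m then 0 else 1)) :
    c.errorProb (diamondOfMAC W)
      = (∑ m, ∑ u, ∑ v, ∑ z, (1 / 8) ^ n * F m u v z) / (M : ℝ) := by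
  unfold DiamondCode.errorProb
  congr 1
  refine Finset.sum_congr rfl fun m _ => Finset.sum_congr rfl fun u _ =>
    Finset.sum_congr rfl fun v _ => ?_
  -- Swapping the two bits puts the determined one second, as `sum_arrow_prod_ite` requires.
  rw [← (Equiv.arrowCongr (Equiv.refl (Fin n)) (Equiv.prodComm Bool Bool)).sum_comp]
  have h1 (y₂ : Fin n → Bool × Bool) (y : Fin n → 𝒴 × (Bool × Bool)) (t : Fin n) :
      ((diamondOfMAC W).mac (c.relay₀ u (c.cf u v y₂) t) (c.relay₁ v (c.cf u v y₂) t)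
        (c.relay₂ y₂ (c.cf u v y₂) t) (y t)).toReal = if (y t).2 = c.relay₂ y₂ (c.cf u v y₂) t then
          (W (c.relay₀ u (c.cf u v y₂) t) (c.relay₁ v (c.cf u v y₂) t) (y t).1).toReal else 0 :=
    diamondOfMAC_mac_toReal W _ _ _ _ _
  have h2 (y₂ : Fin n → Bool × Bool) (t : Fin n) :
      ((diamondOfMAC W).bc (c.enc m t) (u t, v t, ((y₂ t).2, (y₂ t).1))).toReal
        = if (y₂ t).2 = xor (c.enc m t) (select (fun t => (y₂ t).1) u v t) then 1 / 8 else 0 :=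
    diamondOfMAC_bc_toReal W _ _ _ _ _
  simp only [h1]
  have h3 (y₂ : Fin n → Bool × Bool) := sum_arrow_prod_ite
    (fun t y => (W (c.relay₀ u (c.cf u v y₂) t) (c.relay₁ v (c.cf u v y₂) t) y).toReal)
    (fun _ => c.relay₂ y₂ (c.cf u v y₂)) (fun y => if c.dec y = m then 0 else 1)
  simp only [h3]
  have h4 := sum_arrow_prod_ite (n := n) (α := Bool) (β := Bool) (fun _ _ => (1 / 8 : ℝ))
    (fun z t => xor (c.enc m t) (select z u v t)) (fun y₂ => F m u v fun t => (y₂ t).1)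
  simp only [Finset.prod_const, Finset.card_univ, Fintype.card_fin] at h4
  rw [← h4]
  refine Finset.sum_congr rfl fun y₂ _ => ?_
  simp only [← h2]
  by_cases h : ∀ t, (y₂ t).2 = xor (c.enc m t) (select (fun t => (y₂ t).1) u v t)
  · rw [hF m u v (fun t => (y₂ t).1) (fun t => ((y₂ t).2, (y₂ t).1)) (by
      funext t; rw [h t])]
    rfl
  · push Not at h
    obtain ⟨t, ht⟩ := h
    have h0 : ∏ t, ((diamondOfMAC W).bc (c.enc m t) (u t, v t, ((y₂ t).2, (y₂ t).1))).toReal = 0 :=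
      Finset.prod_eq_zero (Finset.mem_univ t) (by rw [h2, if_neg ht])
    rw [h0, zero_mul]
    refine mul_eq_zero_of_left ?_ _
    exact h0

/-! ### Converse for the diamond network without cooperation -/

/-- A form of Fano's inequality, with an arbitrary output distribution `ρ`. -/
theorem fano_le {A 𝒴 : Type*} [Fintype 𝒴] {Q : A → 𝒴 → ℝ} (hQ0 : ∀ a y, 0 ≤ Q a y)
    (hQ : ∀ a, ∑ y, Q a y = 1) {ρ : 𝒴 → ℝ} (hρ0 : ∀ y, 0 ≤ ρ y) (hρ : ∑ y, ρ y ≤ 1)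
    (hQρ : ∀ a y, 0 < Q a y → 0 < ρ y) {M : ℕ} (hM : 0 < M) (φ : Fin M → A) (g : 𝒴 → Fin M) :
    (∑ m, ∑ y, Q (φ m) y * (if g y = m then 1 else 0)) * Real.log M
      ≤ M * Real.log 2 + ∑ m, ∑ y, Q (φ m) y * Real.log (Q (φ m) y / ρ y) := by
  have hM' : (0 : ℝ) < M := by exact_mod_cast hM
  -- Gibbs' inequality compares the joint weight with $\rho(y)$ times $M$ or $1$, according to
  -- whether $y$ decodes to $m$, over $2$. That comparison weight has total mass at most $M$, the
  -- mass of the joint weight; the $2$ is the source of the $\log 2$ term.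
  set h : Fin M × 𝒴 → ℝ := fun i =>
    ρ i.2 / Q (φ i.1) i.2 * (if g i.2 = i.1 then (M : ℝ) else 1) / 2 with hh
  have hpos (i : Fin M × 𝒴) (hi : 0 < Q (φ i.1) i.2) : 0 < h i := by
    have h1 := hQρ _ _ hi
    have h2 : (0 : ℝ) < if g i.2 = i.1 then (M : ℝ) else 1 := by split_ifs <;> positivity
    simp only [hh]
    positivity
  have key := sum_mul_log_le (w := fun i : Fin M × 𝒴 => Q (φ i.1) i.2) (h := h)
    (fun i => hQ0 _ _) hpos
  have hlog (i : Fin M × 𝒴) : Q (φ i.1) i.2 * Real.log (h i)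
      = Q (φ i.1) i.2 * (if g i.2 = i.1 then 1 else 0) * Real.log M
        - Q (φ i.1) i.2 * Real.log (Q (φ i.1) i.2 / ρ i.2) - Q (φ i.1) i.2 * Real.log 2 := by
    rcases (hQ0 (φ i.1) i.2).eq_or_lt with h0 | h0
    · simp [← h0]
    have h1 := hQρ _ _ h0
    have h2 : (0 : ℝ) < if g i.2 = i.1 then (M : ℝ) else 1 := by split_ifs <;> positivity
    have h3 : Real.log (if g i.2 = i.1 then (M : ℝ) else 1)
        = (if g i.2 = i.1 then 1 else 0) * Real.log M := by split_ifs <;> simp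
    rw [hh, Real.log_div (by positivity) (by norm_num), Real.log_mul (by positivity) h2.ne',
      Real.log_div h1.ne' h0.ne', Real.log_div h0.ne' h1.ne', h3]
    ring
  simp only [hlog, Finset.sum_sub_distrib, Fintype.sum_prod_type, ← Finset.sum_mul, hQ] at key
  have hle : ∑ m, ∑ y, Q (φ m) y * h (m, y) ≤ M := by
    calc _ ≤ ∑ m : Fin M, ∑ y, (ρ y / 2 + ρ y * (if g y = m then (M : ℝ) else 0) / 2) := by
          refine Finset.sum_le_sum fun m _ => Finset.sum_le_sum fun y _ => ?_
          have hr := hρ0 y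
          have h4 : (if g y = m then (M : ℝ) else 1) ≤ 1 + (if g y = m then (M : ℝ) else 0) := by
            split_ifs <;> linarith
          rcases (hQ0 (φ m) y).eq_or_lt with h0 | h0
          · rw [← h0, zero_mul]
            have : (0 : ℝ) ≤ if g y = m then (M : ℝ) else 0 := by split_ifs <;> positivity
            positivity
          · have : Q (φ m) y * h (m, y) = ρ y * (if g y = m then (M : ℝ) else 1) / 2 := by
              simp only [hh]; field_simp
            rw [this]
            nlinarith [mul_le_mul_of_nonneg_left h4 hr]
      _ = M * ∑ y, ρ y := by
          rw [Finset.sum_comm]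
          simp only [Finset.sum_add_distrib, ← Finset.sum_div, ← Finset.mul_sum]
          simp
          simp only [← Finset.mul_sum, ← Finset.sum_mul]
          ring
      _ ≤ M := by nlinarith
  simp only [Finset.sum_const, Finset.card_univ, Fintype.card_fin, nsmul_eq_mul, mul_one] at key
  linarith

/-- Fano's inequality when the decoder also sees the channel input masked by the message. -/
theorem fano_masked_le {A 𝒴 : Type*} [Fintype A] [Fintype 𝒴] {Q : A → 𝒴 → ℝ}
    (hQ0 : ∀ a y, 0 ≤ Q a y) (hQ : ∀ a, ∑ y, Q a y = 1) {ρ : 𝒴 → ℝ} (hρ0 : ∀ y, 0 ≤ ρ y)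
    (hρ : ∑ y, ρ y ≤ 1) (hQρ : ∀ a y, 0 < Q a y → 0 < ρ y) {M : ℕ} (hM : 0 < M)
    (σ : Fin M → A ≃ A) (g : A → 𝒴 → Fin M) :
    (∑ m, ∑ a, ∑ y, Q a y * (if g (σ m a) y = m then 1 else 0)) * Real.log M
      ≤ M * (Fintype.card A * Real.log 2 + ∑ a, ∑ y, Q a y * Real.log (Q a y / ρ y)) := by
  -- For a fixed masked word `s` the message determines the input `(σ m).symm s`, so `fano_le`
  -- applies to each `s`; for a fixed message, summing over `s` runs through every input once.
  have e1 (m : Fin M) : ∑ a, ∑ y, Q a y * (if g (σ m a) y = m then (1 : ℝ) else 0)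
      = ∑ s, ∑ y, Q ((σ m).symm s) y * (if g s y = m then 1 else 0) := by
    rw [← (σ m).symm.sum_comp]; simp
  have e2 (m : Fin M) : ∑ s, ∑ y, Q ((σ m).symm s) y * Real.log (Q ((σ m).symm s) y / ρ y)
      = ∑ a, ∑ y, Q a y * Real.log (Q a y / ρ y) :=
    (σ m).symm.sum_comp fun a => ∑ y, Q a y * Real.log (Q a y / ρ y)
  simp only [e1]
  rw [Finset.sum_comm, Finset.sum_mul]
  refine (Finset.sum_le_sum fun s _ =>
    fano_le hQ0 hQ hρ0 hρ hQρ hM (fun m => (σ m).symm s) (g s)).trans (le_of_eq ?_)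
  rw [Finset.sum_add_distrib, Finset.sum_comm]
  simp only [e2]
  simp
  ring

/-- `I(A; Y) + I(B; Y) ≤ I(A, B; Y)` for independent `A`, `B`, where the output law on the right may
be replaced by any `τ`. -/
theorem sum_mutualInfo_le {α β 𝒴 : Type*} [Fintype α] [Fintype β] [Fintype 𝒴] {pa : α → ℝ}
    {pb : β → ℝ} (hpa0 : ∀ a, 0 < pa a) (hpa : ∑ a, pa a = 1) (hpb0 : ∀ b, 0 < pb b)
    (hpb : ∑ b, pb b = 1) {P : α → β → 𝒴 → ℝ} (hP0 : ∀ a b y, 0 ≤ P a b y)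
    (hP : ∀ a b, ∑ y, P a b y = 1) {Q : α → 𝒴 → ℝ} (hQ : ∀ a y, ∑ b, pb b * P a b y = Q a y)
    {Q' : β → 𝒴 → ℝ} (hQ' : ∀ b y, ∑ a, pa a * P a b y = Q' b y) {r : 𝒴 → ℝ}
    (hr : ∀ y, ∑ a, pa a * Q a y = r y) {τ : 𝒴 → ℝ} (hτ0 : ∀ y, 0 ≤ τ y) (hτ : ∑ y, τ y ≤ 1)
    (hPτ : ∀ a b y, 0 < P a b y → 0 < τ y) :
    ∑ a, pa a * ∑ y, Q a y * Real.log (Q a y / r y)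
        + ∑ b, pb b * ∑ y, Q' b y * Real.log (Q' b y / r y)
      ≤ ∑ a, pa a * ∑ b, pb b * ∑ y, P a b y * Real.log (P a b y / τ y) := by
  have hr' (y) : ∑ b, pb b * Q' b y = r y := by
    simp only [← hr, ← hQ, ← hQ', Finset.mul_sum]
    rw [Finset.sum_comm]
    simp only [mul_left_comm]
  have hQ0 (a y) : 0 ≤ Q a y := by
    rw [← hQ]; exact Finset.sum_nonneg fun b _ => mul_nonneg (hpb0 b).le (hP0 _ _ _)
  have hQ'0 (b y) : 0 ≤ Q' b y := by
    rw [← hQ']; exact Finset.sum_nonneg fun b _ => mul_nonneg (hpa0 b).le (hP0 _ _ _)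
  have hQp (a b y) (h : 0 < P a b y) : 0 < Q a y := by
    rw [← hQ]
    exact (mul_pos (hpb0 b) h).trans_le (Finset.single_le_sum (f := fun b => pb b * P a b y)
      (fun b _ => mul_nonneg (hpb0 b).le (hP0 _ _ _)) (Finset.mem_univ b))
  have hQ'p (a b y) (h : 0 < P a b y) : 0 < Q' b y := by
    rw [← hQ']
    exact (mul_pos (hpa0 a) h).trans_le (Finset.single_le_sum (f := fun a => pa a * P a b y)
      (fun b _ => mul_nonneg (hpa0 b).le (hP0 _ _ _)) (Finset.mem_univ a))
  have hrp (a b y) (h : 0 < P a b y) : 0 < r y := by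
    rw [← hr]
    exact (mul_pos (hpa0 a) (hQp a b y h)).trans_le (Finset.single_le_sum
      (f := fun a => pa a * Q a y) (fun b _ => mul_nonneg (hpa0 b).le (hQ0 _ _))
      (Finset.mem_univ a))
  -- The logarithm of this ratio is the left integrand minus the right one. Its mean is at most
  -- $\sum_y r\cdot r\cdot\tau/r^2\le\sum_y\tau\le1$, since `Q` and `Q'` both average to `r`.
  have key := sum_mul_log_le (w := fun i : α × β × 𝒴 => pa i.1 * (pb i.2.1 * P i.1 i.2.1 i.2.2))
    (h := fun i => Q i.1 i.2.2 * Q' i.2.1 i.2.2 * τ i.2.2 / (r i.2.2 ^ 2 * P i.1 i.2.1 i.2.2))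
    (fun i => mul_nonneg (hpa0 _).le (mul_nonneg (hpb0 _).le (hP0 _ _ _)))
    (fun i hi => by
      have h : 0 < P i.1 i.2.1 i.2.2 := (hP0 _ _ _).lt_of_ne fun h0 => by simp [← h0] at hi
      have := hQp _ _ _ h
      have := hQ'p _ _ _ h
      have := hrp _ _ _ h
      have := hPτ _ _ _ h
      positivity)
  have hlog (i : α × β × 𝒴) : pa i.1 * (pb i.2.1 * P i.1 i.2.1 i.2.2) *
      Real.log (Q i.1 i.2.2 * Q' i.2.1 i.2.2 * τ i.2.2 / (r i.2.2 ^ 2 * P i.1 i.2.1 i.2.2))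
      = pa i.1 * (pb i.2.1 * (P i.1 i.2.1 i.2.2 * Real.log (Q i.1 i.2.2 / r i.2.2)))
        + pa i.1 * (pb i.2.1 * (P i.1 i.2.1 i.2.2 * Real.log (Q' i.2.1 i.2.2 / r i.2.2)))
        - pa i.1 * (pb i.2.1 * (P i.1 i.2.1 i.2.2 * Real.log (P i.1 i.2.1 i.2.2 / τ i.2.2))) := by
    rcases (hP0 i.1 i.2.1 i.2.2).eq_or_lt with h0 | h0
    · simp [← h0]
    have h1 := hQp _ _ _ h0
    have h2 := hQ'p _ _ _ h0
    have h3 := hrp _ _ _ h0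
    have h4 := hPτ _ _ _ h0
    rw [Real.log_div (by positivity) (by positivity), Real.log_mul (by positivity) h4.ne',
      Real.log_mul h1.ne' h2.ne', Real.log_mul (by positivity) h0.ne', Real.log_pow,
      Real.log_div h1.ne' h3.ne', Real.log_div h2.ne' h3.ne', Real.log_div h0.ne' h4.ne']
    push_cast
    ring
  have hle : ∑ i : α × β × 𝒴, pa i.1 * (pb i.2.1 * P i.1 i.2.1 i.2.2) *
      (Q i.1 i.2.2 * Q' i.2.1 i.2.2 * τ i.2.2 / (r i.2.2 ^ 2 * P i.1 i.2.1 i.2.2)) ≤ 1 := by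
    calc _ ≤ ∑ i : α × β × 𝒴, pa i.1 * (pb i.2.1 *
          (Q i.1 i.2.2 * (Q' i.2.1 i.2.2 * (τ i.2.2 / r i.2.2 ^ 2)))) := by
          refine Finset.sum_le_sum fun i _ => ?_
          have := (hpa0 i.1).le
          have := (hpb0 i.2.1).le
          have := hQ0 i.1 i.2.2
          have := hQ'0 i.2.1 i.2.2
          have := hτ0 i.2.2
          rcases (hP0 i.1 i.2.1 i.2.2).eq_or_lt with h0 | h0
          · rw [← h0]
            simp only [mul_zero, zero_mul]
            positivity
          · have := hrp _ _ _ h0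
            apply le_of_eq
            field_simp
      _ = ∑ y, r y * (r y * (τ y / r y ^ 2)) := by
          simp only [Fintype.sum_prod_type]
          simp only [← Finset.mul_sum]
          simp only [fun a => sum_mul_sum_mul' pb (Q a) fun b y => Q' b y * (τ y / r y ^ 2)]
          simp only [sum_mul_sum_mul, hr]
          simp only [← mul_assoc, ← Finset.sum_mul, hr']
      _ ≤ ∑ y, τ y := by
          refine Finset.sum_le_sum fun y _ => ?_
          by_cases h : r y = 0
          · simp [h, hτ0]
          · apply le_of_eq
            field_simp
      _ ≤ 1 := hτ
  have hone : ∑ i : α × β × 𝒴, pa i.1 * (pb i.2.1 * P i.1 i.2.1 i.2.2) = 1 := by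
    simp only [Fintype.sum_prod_type, ← Finset.mul_sum, hP, mul_one, hpb, hpa]
  have key := key.trans (sub_le_sub_right hle _)
  simp only [hlog] at key
  rw [hone] at key
  simp only [Finset.sum_add_distrib, Finset.sum_sub_distrib, Fintype.sum_prod_type,
    ← Finset.mul_sum] at key
  have e1 : ∑ a, pa a * ∑ b, pb b * ∑ y, P a b y * Real.log (Q a y / r y)
      = ∑ a, pa a * ∑ y, Q a y * Real.log (Q a y / r y) := by
    refine Finset.sum_congr rfl fun a _ => ?_
    rw [sum_mul_sum_mul]; simp only [hQ]
  have e2 : ∑ a, pa a * ∑ b, pb b * ∑ y, P a b y * Real.log (Q' b y / r y)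
      = ∑ b, pb b * ∑ y, Q' b y * Real.log (Q' b y / r y) := by
    rw [sum_mul_sum_mul']
    refine Finset.sum_congr rfl fun b _ => ?_
    rw [sum_mul_sum_mul]; simp only [hQ']
  linarith

/-! ### Exchanging the selected and unselected bits; the converse. -/

theorem select_select_self {n : ℕ} (z a b : Fin n → Bool) :
    select z (select z a b) (select z b a) = a := by
  funext t; simp only [select]; split_ifs <;> rfl

theorem select_not {n : ℕ} (z a b : Fin n → Bool) :
    select (fun t => !z t) a b = select z b a := by
  funext t; by_cases h : z t <;> simp [select, h]

/-- Exchanging two words at the positions marked by `z` is an involution. -/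
theorem sum_select {n : ℕ} (z : Fin n → Bool) (G : (Fin n → Bool) → (Fin n → Bool) → ℝ) :
    ∑ a, ∑ b, G (select z a b) (select z b a) = ∑ u, ∑ v, G u v := by
  have h : Function.Involutive fun p : (Fin n → Bool) × (Fin n → Bool) =>
      (select z p.1 p.2, select z p.2 p.1) := fun p => by
    simp [select_select_self]
  rw [← Fintype.sum_prod_type' G, ← Fintype.sum_prod_type' fun a b =>
    G (select z a b) (select z b a)]
  exact Equiv.sum_comp h.toPerm fun p => G p.1 p.2

theorem sum_not {n : ℕ} (T : (Fin n → Bool) → ℝ) : ∑ z : Fin n → Bool, T (fun t => !z t) = ∑ z, T z := by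
  have h : Function.Involutive fun (z : Fin n → Bool) (t : Fin n) => !z t := fun z => by simp
  exact Equiv.sum_comp h.toPerm T

theorem sum_output_eq_one {α β 𝒴 : Type*} [Fintype α] [Fintype β] [Fintype 𝒴] {pa : α → ℝ}
    {pb : β → ℝ} (hpa : ∑ a, pa a = 1) (hpb : ∑ b, pb b = 1) {P : α → β → 𝒴 → ℝ}
    (hP : ∀ a b, ∑ y, P a b y = 1) : ∑ y, ∑ a, pa a * ∑ b, pb b * P a b y = 1 := by
  have h (a) : ∑ y, ∑ b, pb b * P a b y = 1 := by
    rw [Finset.sum_comm]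
    simp only [← Finset.mul_sum, hP, mul_one, hpb]
  rw [Finset.sum_comm]
  simp only [← Finset.mul_sum, h, mul_one, hpa]

/-- Single-letter bound on the information carried by a block of outputs. -/
theorem sum_log_prod_le {α β 𝒴 : Type*} [Fintype α] [Fintype β] [Fintype 𝒴] {pa : α → ℝ}
    {pb : β → ℝ} {n : ℕ} {V : Fin n → α → β → 𝒴 → ℝ} (hV0 : ∀ t a b y, 0 ≤ V t a b y)
    (hV : ∀ t a b, ∑ y, V t a b y = 1) {r : Fin n → 𝒴 → ℝ}
    (hr : ∀ t y, ∑ a, pa a * ∑ b, pb b * V t a b y = r t y)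
    (hVr : ∀ t a b y, 0 < V t a b y → 0 < r t y) {B : ℝ}
    (hB : ∀ t, mutualInfo pa pb (V t) ≤ B) :
    ∑ a, pa a * ∑ b, pb b * ∑ y : Fin n → 𝒴, (∏ t, V t a b (y t)) *
      Real.log ((∏ t, V t a b (y t)) / ∏ t, r t (y t)) ≤ n * B := by
  have h (a b) : ∑ y : Fin n → 𝒴, (∏ t, V t a b (y t)) *
      Real.log ((∏ t, V t a b (y t)) / ∏ t, r t (y t))
        = ∑ t, ∑ y, V t a b y * Real.log (V t a b y / r t y) := by
    have h1 (y : Fin n → 𝒴) : (∏ t, V t a b (y t)) *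
        Real.log ((∏ t, V t a b (y t)) / ∏ t, r t (y t))
          = ∑ t, (∏ t, V t a b (y t)) * Real.log (V t a b (y t) / r t (y t)) := by
      rw [← Finset.mul_sum]
      by_cases h0 : ∏ t, V t a b (y t) = 0
      · simp [h0]
      have hp (t) : 0 < V t a b (y t) :=
        (hV0 _ _ _ _).lt_of_ne fun h2 => h0 (Finset.prod_eq_zero (Finset.mem_univ t) h2.symm)
      rw [← Finset.prod_div_distrib, Real.log_prod]
      exact fun t _ => (div_pos (hp t) (hVr t a b _ (hp t))).ne'
    simp only [h1]
    rw [Finset.sum_comm]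
    exact Finset.sum_congr rfl fun t _ => sum_pi_prod_mul_apply (p := fun t => V t a b)
      (fun t => hV t a b) t fun y => Real.log (V t a b y / r t y)
  simp only [h]
  have h2 : ∑ a, pa a * ∑ b, pb b * ∑ t, ∑ y, V t a b y * Real.log (V t a b y / r t y)
      = ∑ t, mutualInfo pa pb (V t) := by
    simp only [mutualInfo, hr]
    rw [Finset.sum_comm]
    refine Finset.sum_congr rfl fun a _ => ?_
    rw [← Finset.mul_sum, Finset.sum_comm]
    simp only [← Finset.mul_sum]
  rw [h2]
  refine (Finset.sum_le_sum fun t _ => hB t).trans (le_of_eq (by simp))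

/-- The $n$-letter converse: masked Fano for each `z`, then pairing `z` with its complement. With a
single index `k` each relay's input is a function of its own block, so the two inputs are
independent. -/
theorem diamond_correct_mul_log_le {𝒴 : Type*} [Fintype 𝒴] (W : Bool → Bool → PMF 𝒴)
    {n M K : ℕ} [Subsingleton (Fin K)] (hM : 0 < M)
    (c : DiamondCode Bool Bool Bool (Bool × Bool) Bool Bool (Bool × Bool) (𝒴 × (Bool × Bool))
      n M K) :
    (1 - c.errorProb (diamondOfMAC W)) * Real.log M
      ≤ Real.log 2 + n * (macSumCapacity W 0 * Real.log 2) / 2 := by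
  set k : Fin K := c.cf (fun _ => false) (fun _ => false) (fun _ => (false, false)) with hk
  set V : Fin n → (Fin n → Bool) → (Fin n → Bool) → 𝒴 → ℝ := fun t u v y =>
    (W (c.relay₀ u k t) (c.relay₁ v k t) y).toReal with hVdef
  have hV0 (t u v y) : 0 ≤ V t u v y := ENNReal.toReal_nonneg
  have hV (t u v) : ∑ y, V t u v y = 1 := PMF.sum_toReal _
  set N : ℝ := 2 ^ n with hN
  have hNpos : 0 < N := by positivity
  set p : (Fin n → Bool) → ℝ := fun _ => N⁻¹ with hp
  have hp0 (a) : 0 < p a := inv_pos.2 hNpos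
  have hps : ∑ a, p a = 1 := by simp [hp, hN]
  set P : (Fin n → Bool) → (Fin n → Bool) → (Fin n → 𝒴) → ℝ := fun u v y =>
    ∏ t, V t u v (y t) with hPdef
  have hP0 (u v y) : 0 ≤ P u v y := Finset.prod_nonneg fun _ _ => hV0 _ _ _ _
  have hP (u v) : ∑ y, P u v y = 1 := sum_prod_channel fun t => W (c.relay₀ u k t) (c.relay₁ v k t)
  set ρ : Fin n → 𝒴 → ℝ := fun t y => ∑ a, p a * ∑ b, p b * V t a b y with hρ
  have hρ0 (t y) : 0 ≤ ρ t y := Finset.sum_nonneg fun a _ => mul_nonneg (hp0 a).le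
    (Finset.sum_nonneg fun b _ => mul_nonneg (hp0 b).le (hV0 _ _ _ _))
  have hρs (t) : ∑ y, ρ t y = 1 :=
    sum_output_eq_one hps hps (hV t)
  have hVρ (t a b y) (h : 0 < V t a b y) : 0 < ρ t y := by
    refine (mul_pos (hp0 a) (mul_pos (hp0 b) h)).trans_le
      (le_trans ?_ (Finset.single_le_sum (f := fun a => p a * ∑ b, p b * V t a b y)
      (fun a _ => mul_nonneg (hp0 a).le (Finset.sum_nonneg fun b _ =>
        mul_nonneg (hp0 b).le (hV0 _ _ _ _))) (Finset.mem_univ a)))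
    exact mul_le_mul_of_nonneg_left (Finset.single_le_sum (f := fun b => p b * V t a b y)
      (fun b _ => mul_nonneg (hp0 b).le (hV0 _ _ _ _)) (Finset.mem_univ b)) (hp0 a).le
  have hI : ∑ a, p a * ∑ b, p b * ∑ y, P a b y * Real.log (P a b y / ∏ t, ρ t (y t))
      ≤ n * (macSumCapacity W 0 * Real.log 2) :=
    sum_log_prod_le hV0 hV (fun _ _ => rfl) hVρ fun t =>
      mutualInfo_le_macSumCapacity (fun a => (hp0 a).le) hps (fun a => (hp0 a).le) hps W
        (fun u => c.relay₀ u k t) (fun v => c.relay₁ v k t)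
  -- The channel from the selected bits `a` to the output, the unselected bits `b` being averaged
  -- out; `select z a b` and `select z b a` recover the two received blocks.
  set Q : (Fin n → Bool) → (Fin n → Bool) → (Fin n → 𝒴) → ℝ := fun z a y =>
    ∑ b, p b * P (select z a b) (select z b a) y with hQ
  have hQ0 (z a y) : 0 ≤ Q z a y := Finset.sum_nonneg fun b _ => mul_nonneg (hp0 b).le (hP0 _ _ _)
  have hQs (z a) : ∑ y, Q z a y = 1 := by
    simp only [hQ]
    rw [Finset.sum_comm]
    simp only [← Finset.mul_sum, hP, mul_one, hps]
  set r : (Fin n → 𝒴) → ℝ := fun y => ∑ u, p u * ∑ v, p v * P u v y with hr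
  have hQr (z y) : ∑ a, p a * Q z a y = r y := by
    simp only [hQ, hr, Finset.mul_sum]
    exact sum_select z fun u v => N⁻¹ * (N⁻¹ * P u v y)
  have hr0 (y) : 0 ≤ r y := Finset.sum_nonneg fun a _ => mul_nonneg (hp0 a).le
    (Finset.sum_nonneg fun b _ => mul_nonneg (hp0 b).le (hP0 _ _ _))
  have hrs : ∑ y, r y = 1 :=
    sum_output_eq_one hps hps hP
  set T : (Fin n → Bool) → ℝ := fun z => ∑ a, p a * ∑ y, Q z a y * Real.log (Q z a y / r y) with hT
  -- Complementing `z` exchanges `a` and `b`, so `T` at the complement is the information carried by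
  -- `b`. The reference law `τ` is the product of the one-letter output laws, for which `hI` is the
  -- single-letter bound.
  have hpair (z) : T z + T (fun t => !z t) ≤ n * (macSumCapacity W 0 * Real.log 2) := by
    refine le_trans (sum_mutualInfo_le hp0 hps hp0 hps
      (P := fun a b y => P (select z a b) (select z b a) y) (fun _ _ => hP0 _ _) (fun _ _ => hP _ _)
      (fun _ _ => rfl) (Q' := Q fun t => !z t) (fun b y => by simp only [hQ, select_not])
      (hQr z) (τ := fun y => ∏ t, ρ t (y t)) (fun y => Finset.prod_nonneg fun t _ => hρ0 _ _)
      (sum_pi_prod_eq_one hρs).le fun a b y h => Finset.prod_pos fun t _ => ?_) ?_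
    · exact hVρ t _ _ _ ((hV0 _ _ _ _).lt_of_ne fun h2 =>
        h.ne' (Finset.prod_eq_zero (Finset.mem_univ t) h2.symm))
    · refine le_of_eq_of_le ?_ hI
      simp only [Finset.mul_sum]
      exact sum_select z fun u v => ∑ y, N⁻¹ * (N⁻¹ * (P u v y *
        Real.log (P u v y / ∏ t, ρ t (y t))))
  have hTsum : ∑ z, T z ≤ N * (n * (macSumCapacity W 0 * Real.log 2)) / 2 := by
    have h1 := Finset.sum_le_sum fun z (_ : z ∈ Finset.univ) => hpair z
    rw [Finset.sum_add_distrib, sum_not T] at h1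
    simp only [Finset.sum_const, Finset.card_univ, Fintype.card_fun, Fintype.card_bool,
      Fintype.card_fin, nsmul_eq_mul] at h1
    push_cast at h1
    linarith
  set g : (Fin n → Bool) → (Fin n → Bool) → (Fin n → 𝒴) → Fin M := fun z s y =>
    c.dec fun t => (y t, c.relay₂ (fun t => (s t, z t)) k t) with hg
  set σ : Fin M → (Fin n → Bool) ≃ (Fin n → Bool) := fun m =>
    Function.Involutive.toPerm (fun a t => xor (c.enc m t) (a t)) fun a => by simp with hσ
  have hfano (z) := fano_masked_le (hQ0 z) (hQs z) hr0 hrs.le (fun a y h => by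
    rw [← hQr z]
    exact (mul_pos (hp0 a) h).trans_le (Finset.single_le_sum (f := fun a => p a * Q z a y)
      (fun b _ => mul_nonneg (hp0 b).le (hQ0 _ _ _)) (Finset.mem_univ a))) hM σ (g z)
  have hT' (z) : ∑ a, ∑ y, Q z a y * Real.log (Q z a y / r y) = N * T z := by
    simp only [hT, hp, ← Finset.mul_sum]
    rw [mul_inv_cancel_left₀ hNpos.ne']
  have hcorr (z m) : ∑ u, ∑ v, ∑ y, P u v y * (if g z (σ m (select z u v)) y = m then (1 : ℝ) else 0)
      = N * ∑ a, ∑ y, Q z a y * (if g z (σ m a) y = m then 1 else 0) := by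
    rw [← sum_select z, Finset.mul_sum]
    refine Finset.sum_congr rfl fun a _ => ?_
    simp only [select_select_self, hQ]
    rw [← sum_mul_sum_mul]
    simp only [hp, ← Finset.mul_sum]
    rw [mul_inv_cancel_left₀ hNpos.ne']
  have hM' : (0 : ℝ) < M := by exact_mod_cast hM
  have herr : (1 - c.errorProb (diamondOfMAC W)) * (M * N ^ 2)
      = ∑ z, ∑ m, ∑ a, ∑ y, Q z a y * (if g z (σ m a) y = m then 1 else 0) := by
    rw [diamondCode_errorProb_eq W c (fun m u v z => ∑ y, P u v y *
      (if g z (σ m (select z u v)) y = m then 0 else 1)) (by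
        rintro m u v z _ rfl
        simp only [Subsingleton.elim (c.cf _ _ _) k]
        rfl)]
    have h1 (m u v z) : ∑ y, P u v y * (if g z (σ m (select z u v)) y = m then (0 : ℝ) else 1)
        = 1 - ∑ y, P u v y * (if g z (σ m (select z u v)) y = m then 1 else 0) := by
      rw [eq_sub_iff_add_eq, ← Finset.sum_add_distrib]
      refine Eq.trans (Finset.sum_congr rfl fun y _ => ?_) (hP u v)
      split_ifs <;> ring
    simp only [h1, mul_sub, Finset.sum_sub_distrib, mul_one]
    have h8 : (1 / 8 : ℝ) ^ n = (N ^ 3)⁻¹ := by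
      rw [hN, ← pow_mul, mul_comm n 3, pow_mul, ← inv_pow]; norm_num
    have h2 : ∑ m, ∑ u, ∑ v, ∑ z, (1 / 8 : ℝ) ^ n * ∑ y, P u v y *
        (if g z (σ m (select z u v)) y = m then (1 : ℝ) else 0)
        = (N ^ 2)⁻¹ * ∑ z, ∑ m, ∑ a, ∑ y, Q z a y * (if g z (σ m a) y = m then 1 else 0) := by
      rw [Finset.sum_comm (s := (Finset.univ : Finset (Fin n → Bool)))
        (t := (Finset.univ : Finset (Fin M))), Finset.mul_sum]
      refine Finset.sum_congr rfl fun m _ => ?_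
      have h3 (u : Fin n → Bool) := Finset.sum_comm (s := (Finset.univ : Finset (Fin n → Bool)))
        (t := (Finset.univ : Finset (Fin n → Bool))) (f := fun v z => (1 / 8 : ℝ) ^ n * ∑ y,
          P u v y * (if g z (σ m (select z u v)) y = m then (1 : ℝ) else 0))
      simp only [h3]
      rw [Finset.sum_comm, Finset.mul_sum]
      refine Finset.sum_congr rfl fun z _ => ?_
      simp only [← Finset.mul_sum]
      rw [hcorr, h8]
      field_simp
    rw [h2, h8]
    simp only [Finset.sum_const, Finset.card_univ, Fintype.card_fun, Fintype.card_bool,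
      Fintype.card_fin, nsmul_eq_mul]
    push_cast
    rw [← hN]
    field_simp
    ring
  have hsum := Finset.sum_le_sum fun z (_ : z ∈ Finset.univ) => hfano z
  rw [← Finset.sum_mul, ← herr] at hsum
  simp only [hT', ← Finset.mul_sum, Finset.sum_add_distrib, Finset.sum_const, Finset.card_univ,
    Fintype.card_fun, Fintype.card_bool, Fintype.card_fin, nsmul_eq_mul] at hsum
  push_cast at hsum
  rw [← hN] at hsum
  have h1 : 0 < (M : ℝ) * N ^ 2 := by positivity
  refine le_of_mul_le_mul_right ?_ h1
  have h2 := mul_le_mul_of_nonneg_left hTsum (by positivity : 0 ≤ (M : ℝ) * N)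
  linarith

/-! ### From a code with cooperation for the MAC to a code for the diamond network -/

/-- The messages of a code may be drawn through arbitrary maps, up to a cyclic shift, without
increasing the average of a nonnegative cost. -/
theorem exists_shift_average_le {α β : Type*} [Fintype α] [Fintype β] [Nonempty α] [Nonempty β]
    {M₀ M₁ : ℕ} [NeZero M₀] [NeZero M₁] (e : Fin M₀ → Fin M₁ → ℝ) (ι₀ : α → Fin M₀)
    (ι₁ : β → Fin M₁) :
    ∃ s₀ s₁, (∑ a, ∑ b, e (ι₀ a + s₀) (ι₁ b + s₁)) / ((Fintype.card α : ℝ) * Fintype.card β)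
      ≤ (∑ m₀, ∑ m₁, e m₀ m₁) / ((M₀ : ℝ) * M₁) := by
  have h₀ : (0 : ℝ) < M₀ := by exact_mod_cast NeZero.pos M₀
  have h₁ : (0 : ℝ) < M₁ := by exact_mod_cast NeZero.pos M₁
  have ha : (0 : ℝ) < Fintype.card α := by exact_mod_cast Fintype.card_pos
  have hb : (0 : ℝ) < Fintype.card β := by exact_mod_cast Fintype.card_pos
  obtain ⟨s, hs⟩ := exists_le_of_sum_mul_le (ι := Fin M₀ × Fin M₁)
    (w := fun _ => ((M₀ : ℝ) * M₁)⁻¹)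
    (f := fun s => (∑ a, ∑ b, e (ι₀ a + s.1) (ι₁ b + s.2)) /
      ((Fintype.card α : ℝ) * Fintype.card β))
    (B := (∑ m₀, ∑ m₁, e m₀ m₁) / ((M₀ : ℝ) * M₁))
    (fun _ => by positivity) (by simp; field_simp) (by
      -- For fixed `a` and `b`, a uniform shift makes the message pair uniform, however uneven `ι₀`
      -- and `ι₁` are.
      have h (a b) : ∑ s : Fin M₀ × Fin M₁, e (ι₀ a + s.1) (ι₁ b + s.2) = ∑ m₀, ∑ m₁, e m₀ m₁ := by
        rw [Fintype.sum_prod_type]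
        exact (Equiv.sum_comp (Equiv.addLeft (ι₀ a)) fun m₀ => ∑ s, e m₀ (ι₁ b + s)).trans
          (Finset.sum_congr rfl fun m₀ _ => Equiv.sum_comp (Equiv.addLeft (ι₁ b)) (e m₀))
      rw [← Finset.mul_sum, ← Finset.sum_div, Finset.sum_comm]
      simp only [fun a => Finset.sum_comm (s := (Finset.univ : Finset (Fin M₀ × Fin M₁)))
        (t := (Finset.univ : Finset β)) (f := fun s b => e (ι₀ a + s.1) (ι₁ b + s.2)), h]
      apply le_of_eq
      simp
      field_simp)
  exact ⟨s.1, s.2, hs⟩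

/-- Embeds the $2^k$ prefixes into the message set, so that a decoded MAC message reveals the first
`k` bits of the relay's block. -/
theorem exists_prefix_map {n k M : ℕ} (hk : k ≤ n) (hM : 2 ^ k ≤ M) :
    ∃ ι : (Fin n → Bool) → Fin M, ∀ u u', ι u = ι u' → ∀ t : Fin n, (t : ℕ) < k → u t = u' t := by
  obtain ⟨f⟩ : Nonempty ((Fin k → Bool) ↪ Fin M) := by
    apply Function.Embedding.nonempty_of_card_le
    simpa using hM
  refine ⟨fun u => f fun i => u (Fin.castLE hk i), fun u u' h t ht => ?_⟩
  exact congrFun (f.injective h) ⟨t, ht⟩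

/-! ### The erasure channel seen by the terminal. -/

/-- Whether the terminal knows the `t`-th bit of `Y_Z` when it knows the first `k₀` bits of `Y₀` and
the first `k₁` bits of `Y₁`. -/
def Known {n : ℕ} (k₀ k₁ : ℕ) (z : Fin n → Bool) (t : Fin n) : Prop :=
  (t : ℕ) < if z t then k₁ else k₀

instance {n : ℕ} (k₀ k₁ : ℕ) (z : Fin n → Bool) : DecidablePred (Known k₀ k₁ z) :=
  fun _ => inferInstanceAs (Decidable (_ < _))

/-- The probability is $2^{-|S|}$, written as an exponential so that $|S|$ can be compared with a
real threshold. -/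
theorem sum_agree_eq {n : ℕ} (S : Fin n → Prop) [DecidablePred S] (x : Fin n → Bool) :
    ∑ x' : Fin n → Bool, ((2 : ℝ) ^ n)⁻¹ * (if ∀ t, S t → x' t = x t then 1 else 0)
      = Real.exp (-(Real.log 2 * ∑ t, if S t then 1 else 0)) := by
  have h (x' : Fin n → Bool) : ((2 : ℝ) ^ n)⁻¹ * (if ∀ t, S t → x' t = x t then 1 else 0)
      = ∏ t, (2⁻¹ * if S t → x' t = x t then (1 : ℝ) else 0) := by
    rw [Finset.prod_mul_distrib]
    congr 1
    · simp
    · rw [Finset.prod_ite_zero]; simp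
  simp only [h]
  rw [sum_pi_prod (fun t b => (2⁻¹ * if S t → b = x t then (1 : ℝ) else 0)), Finset.mul_sum,
    ← Finset.sum_neg_distrib, Real.exp_sum]
  refine Finset.prod_congr rfl fun t _ => ?_
  by_cases hS : S t
  · cases x t <;> simp [hS, Real.exp_neg, Real.exp_log]
  · simp [hS]

theorem sum_fin_lt {n k : ℕ} (hk : k ≤ n) : ∑ t : Fin n, (if (t : ℕ) < k then (1 : ℝ) else 0) = k := by
  rw [Fin.sum_univ_eq_sum_range (fun t => if t < k then (1 : ℝ) else 0), ← Finset.sum_filter]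
  have : (Finset.range n).filter (fun t => t < k) = Finset.range k := by
    ext t; simp; omega
  simp [this]

open Classical in
/-- The number of known positions concentrates around its mean `(k₀ + k₁) / 2`. -/
theorem sum_known_le {n k₀ k₁ : ℕ} (hk₀ : k₀ ≤ n) (hk₁ : k₁ ≤ n) {τ : ℝ} (hτ : 0 < τ) :
    ∑ z : Fin n → Bool, ((2 : ℝ) ^ n)⁻¹ *
        (if ∑ t, (if Known k₀ k₁ z t then (1 : ℝ) else 0) ≤ (k₀ + k₁ : ℝ) / 2 - τ then 1 else 0)
      ≤ n / τ ^ 2 := by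
  have key := sum_pi_prod_mul_ite_le (ι := Fin n) (α := Bool) (p := fun _ _ => 2⁻¹)
    (fun _ _ => by norm_num) (fun _ => by norm_num)
    (fun t b => (if (t : ℕ) < (if b then k₁ else k₀) then (1 : ℝ) else 0)
      - ((if (t : ℕ) < k₀ then 1 else 0) + (if (t : ℕ) < k₁ then 1 else 0)) / 2)
    (fun t => by simp; ring) (σ := 1)
    (fun t => by simp; split_ifs <;> norm_num) hτ
  simp only [Fintype.card_fin, mul_one, Finset.prod_const, Finset.card_univ] at key
  refine le_of_eq_of_le (Finset.sum_congr rfl fun z _ => ?_) key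
  rw [inv_pow]
  congr 1
  have : ∑ t : Fin n, ((if (t : ℕ) < (if z t then k₁ else k₀) then (1 : ℝ) else 0)
      - ((if (t : ℕ) < k₀ then 1 else 0) + (if (t : ℕ) < k₁ then 1 else 0)) / 2)
      = ∑ t, (if Known k₀ k₁ z t then (1 : ℝ) else 0) - (k₀ + k₁ : ℝ) / 2 := by
    rw [Finset.sum_sub_distrib, ← Finset.sum_div, Finset.sum_add_distrib, sum_fin_lt hk₀,
      sum_fin_lt hk₁]
    rfl
  rw [this]
  refine if_congr ⟨fun h => by linarith, fun h => by linarith⟩ rfl rfl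

open Classical in
/-- A codebook for which the known positions determine the message with high probability. -/
theorem exists_erasure_codebook {n k₀ k₁ M : ℕ} (hk₀ : k₀ ≤ n) (hk₁ : k₁ ≤ n) (hM : 0 < M) {τ : ℝ}
    (hτ : 0 < τ) :
    ∃ x : Fin M → Fin n → Bool, (∑ m, ∑ z, ((2 : ℝ) ^ n)⁻¹ *
        (if ∃ m', m' ≠ m ∧ ∀ t, Known k₀ k₁ z t → x m' t = x m t then 1 else 0)) / (M : ℝ)
      ≤ n / τ ^ 2 + M * Real.exp (-(Real.log 2 * ((k₀ + k₁ : ℝ) / 2 - τ))) := by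
  have hM' : (0 : ℝ) < M := by exact_mod_cast hM
  have hl : 0 < Real.log 2 := Real.log_pos (by norm_num)
  have hu : ∑ _x : Fin n → Bool, ((2 : ℝ) ^ n)⁻¹ = 1 := by simp
  have hw0 (x : Fin M → Fin n → Bool) : (0 : ℝ) ≤ ∏ _m : Fin M, ((2 : ℝ) ^ n)⁻¹ := by positivity
  have hw : ∑ _x : Fin M → Fin n → Bool, ∏ _m : Fin M, ((2 : ℝ) ^ n)⁻¹ = 1 :=
    sum_pi_prod_eq_one (p := fun (_ : Fin M) (_ : Fin n → Bool) => ((2 : ℝ) ^ n)⁻¹) fun _ => hu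
  set B : (Fin n → Bool) → ℝ := fun z =>
    (if ∑ t, (if Known k₀ k₁ z t then (1 : ℝ) else 0) ≤ (k₀ + k₁ : ℝ) / 2 - τ then 1 else 0)
    with hB
  set η : ℝ := M * Real.exp (-(Real.log 2 * ((k₀ + k₁ : ℝ) / 2 - τ))) with hη
  -- Either `z` leaves too few known positions, which `B` pays for, or a union bound over the other
  -- codewords gives `η`.
  have hmz (m : Fin M) (z : Fin n → Bool) : ∑ x : Fin M → Fin n → Bool,
      (∏ _m : Fin M, ((2 : ℝ) ^ n)⁻¹) *
        (if ∃ m', m' ≠ m ∧ ∀ t, Known k₀ k₁ z t → x m' t = x m t then 1 else 0) ≤ B z + η := by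
    by_cases hz : ∑ t, (if Known k₀ k₁ z t then (1 : ℝ) else 0) ≤ (k₀ + k₁ : ℝ) / 2 - τ
    · have h1 : B z = 1 := if_pos hz
      have h2 : 0 ≤ η := by positivity
      rw [h1]
      refine le_trans (le_trans (Finset.sum_le_sum fun x _ => mul_le_of_le_one_right (hw0 x) ?_)
        hw.le) (by linarith)
      split_ifs <;> norm_num
    · have h1 : B z = 0 := if_neg hz
      rw [h1, zero_add]
      calc _ ≤ ∑ x : Fin M → Fin n → Bool, (∏ _m : Fin M, ((2 : ℝ) ^ n)⁻¹) *
              ∑ m' ∈ Finset.univ.erase m,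
                (if ∀ t, Known k₀ k₁ z t → x m' t = x m t then 1 else 0) := by
            refine Finset.sum_le_sum fun x _ => mul_le_mul_of_nonneg_left ?_ (hw0 x)
            have hn : ∀ m' ∈ Finset.univ.erase m, (0 : ℝ) ≤
                (if ∀ t, Known k₀ k₁ z t → x m' t = x m t then 1 else 0) := fun m' _ => by
              split_ifs <;> norm_num
            split_ifs with h
            · obtain ⟨m', h1, h2⟩ := h
              refine le_of_eq_of_le ?_ (Finset.single_le_sum hn
                (Finset.mem_erase.2 ⟨h1, Finset.mem_univ m'⟩))
              rw [if_pos h2]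
            · exact Finset.sum_nonneg hn
        _ = ∑ m' ∈ Finset.univ.erase m,
              Real.exp (-(Real.log 2 * ∑ t, if Known k₀ k₁ z t then 1 else 0)) := by
            simp only [Finset.mul_sum (Finset.univ.erase m)]
            rw [Finset.sum_comm]
            refine Finset.sum_congr rfl fun m' hm' => ?_
            rw [sum_pi_prod_mul_apply₂ (p := fun _ _ => ((2 : ℝ) ^ n)⁻¹) (fun _ => hu)
              (Finset.ne_of_mem_erase hm').symm
              (fun x x' => if ∀ t, Known k₀ k₁ z t → x' t = x t then 1 else 0)]
            have h3 (x : Fin n → Bool) := sum_agree_eq (Known k₀ k₁ z) x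
            refine Eq.trans (Finset.sum_congr rfl fun x _ => congrArg _ (Eq.trans ?_ (h3 x)))
              (by rw [← Finset.sum_mul, hu, one_mul])
            congr!
        _ ≤ ∑ m' ∈ Finset.univ.erase m,
              Real.exp (-(Real.log 2 * ((k₀ + k₁ : ℝ) / 2 - τ))) := by
            gcongr
            linarith
        _ ≤ η := by
            rw [Finset.sum_const, nsmul_eq_mul, hη]
            gcongr
            exact_mod_cast (Finset.card_le_univ _).trans (by simp)
  have hBs : ∑ z, ((2 : ℝ) ^ n)⁻¹ * B z ≤ n / τ ^ 2 := by
    refine le_of_eq_of_le ?_ (sum_known_le hk₀ hk₁ hτ)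
    rfl
  refine exists_le_of_sum_mul_le (w := fun _ => ∏ _m : Fin M, ((2 : ℝ) ^ n)⁻¹) hw0 hw ?_
  simp_rw [← mul_div_assoc, ← Finset.sum_div]
  rw [div_le_iff₀ hM']
  calc _ = ∑ m : Fin M, ∑ z : Fin n → Bool, ((2 : ℝ) ^ n)⁻¹ * ∑ x : Fin M → Fin n → Bool,
        (∏ _m : Fin M, ((2 : ℝ) ^ n)⁻¹) *
          (if ∃ m', m' ≠ m ∧ ∀ t, Known k₀ k₁ z t → x m' t = x m t then 1 else 0) := by
        simp only [Finset.mul_sum]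
        rw [Finset.sum_comm]
        refine Finset.sum_congr rfl fun m _ => ?_
        rw [Finset.sum_comm]
        simp only [mul_left_comm]
    _ ≤ ∑ m : Fin M, ∑ z : Fin n → Bool, ((2 : ℝ) ^ n)⁻¹ * (B z + η) := by
        gcongr with m _ z
        exact hmz m z
    _ = (∑ z, ((2 : ℝ) ^ n)⁻¹ * B z + η) * M := by
        simp only [mul_add, Finset.sum_add_distrib, ← Finset.sum_mul, hu]
        simp
        ring
    _ ≤ _ := by gcongr

/-- Errors have two sources: the MAC decoder misses the shifted prefix indices, or another codeword
agrees with the true one at all known positions. The three terms of the bound are the MAC error, the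
chance of too few known positions, and the collision probability. -/
theorem exists_diamondCode {𝒴 : Type*} [Fintype 𝒴] (W : Bool → Bool → PMF 𝒴) {n M₀ M₁ K k₀ k₁ M : ℕ}
    (hk₀ : k₀ ≤ n) (hk₁ : k₁ ≤ n) (hM₀ : 2 ^ k₀ ≤ M₀) (hM₁ : 2 ^ k₁ ≤ M₁) (hM : 0 < M)
    (c : MACCode Bool Bool 𝒴 n M₀ M₁ K) {τ : ℝ} (hτ : 0 < τ) :
    ∃ d : DiamondCode Bool Bool Bool (Bool × Bool) Bool Bool (Bool × Bool) (𝒴 × (Bool × Bool)) n M K,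
      d.errorProb (diamondOfMAC W) ≤ c.errorProb W +
        (n / τ ^ 2 + M * Real.exp (-(Real.log 2 * ((k₀ + k₁ : ℝ) / 2 - τ)))) := by
  classical
  have : NeZero M₀ := ⟨((Nat.two_pow_pos k₀).trans_le hM₀).ne'⟩
  have : NeZero M₁ := ⟨((Nat.two_pow_pos k₁).trans_le hM₁).ne'⟩
  have hM' : (0 : ℝ) < M := by exact_mod_cast hM
  set V : Fin M₀ → Fin M₁ → (Fin n → 𝒴) → ℝ := fun m₀ m₁ y =>
    ∏ t, (W (c.enc₀ m₀ (c.cf m₀ m₁) t) (c.enc₁ m₁ (c.cf m₀ m₁) t) (y t)).toReal with hV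
  have hV0 (m₀ m₁ y) : 0 ≤ V m₀ m₁ y := prod_channel_nonneg (fun t => W _ _) y
  have hVs (m₀ m₁) : ∑ y, V m₀ m₁ y = 1 :=
    sum_prod_channel fun t => W (c.enc₀ m₀ (c.cf m₀ m₁) t) (c.enc₁ m₁ (c.cf m₀ m₁) t)
  set e : Fin M₀ → Fin M₁ → ℝ := fun m₀ m₁ => ∑ y, V m₀ m₁ y *
    (if c.dec y = (m₀, m₁) then 0 else 1) with he
  obtain ⟨ι₀, hι₀⟩ := exists_prefix_map hk₀ hM₀
  obtain ⟨ι₁, hι₁⟩ := exists_prefix_map hk₁ hM₁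
  obtain ⟨s₀, s₁, hs⟩ := exists_shift_average_le e ι₀ ι₁
  obtain ⟨x, hx⟩ := exists_erasure_codebook hk₀ hk₁ hM hτ
  set E : Fin M → (Fin n → Bool) → ℝ := fun m z =>
    (if ∃ m', m' ≠ m ∧ ∀ t, Known k₀ k₁ z t → x m' t = x m t then 1 else 0) with hE
  -- Message `m` is consistent with what the terminal sees if some blocks `u`, `v` with the decoded
  -- indices explain `s`. The decoder returns any consistent message; the true one is consistent
  -- when the indices are right.
  set Cons : Fin M₀ × Fin M₁ → (Fin n → Bool) → (Fin n → Bool) → Fin M → Prop := fun p s z m =>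
    ∃ u v, p = (ι₀ u + s₀, ι₁ v + s₁) ∧ ∀ t, s t = xor (x m t) (select z u v t) with hCons
  have hdec (p s z) : ∃ m : Fin M, (∃ m', Cons p s z m') → Cons p s z m := by
    by_cases h : ∃ m', Cons p s z m'
    · obtain ⟨m, hm⟩ := h
      exact ⟨m, fun _ => hm⟩
    · exact ⟨⟨0, hM⟩, fun h' => absurd h' h⟩
  choose dec hdec using hdec
  have hdecE (u v z m) : (if dec (ι₀ u + s₀, ι₁ v + s₁)
      (fun t => xor (x m t) (select z u v t)) z = m then (0 : ℝ) else 1) ≤ E m z := by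
    simp only [hE]
    split_ifs with h1 h2 h2
    any_goals norm_num
    apply h2
    obtain ⟨u', v', hp, ht⟩ := hdec (ι₀ u + s₀, ι₁ v + s₁)
      (fun t => xor (x m t) (select z u v t)) z ⟨m, u, v, rfl, fun _ => rfl⟩
    refine ⟨_, h1, fun t hk => ?_⟩
    have hsel : select z u v t = select z u' v' t := by
      simp only [Prod.mk.injEq, add_left_inj] at hp
      unfold Known at hk
      unfold select
      split_ifs at hk ⊢ with hz
      · exact hι₁ v v' hp.2 t hk
      · exact hι₀ u u' hp.1 t hk
    have h3 : xor (x m t) (select z u v t) = _ := ht t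
    rw [hsel] at h3
    exact (Bool.xor_left_inj.1 h3).symm
  set d : DiamondCode Bool Bool Bool (Bool × Bool) Bool Bool (Bool × Bool) (𝒴 × (Bool × Bool))
      n M K :=
    { enc := x
      cf := fun u v _ => c.cf (ι₀ u + s₀) (ι₁ v + s₁)
      relay₀ := fun u k => c.enc₀ (ι₀ u + s₀) k
      relay₁ := fun v k => c.enc₁ (ι₁ v + s₁) k
      relay₂ := fun y₂ _ => y₂
      dec := fun y => dec (c.dec fun t => (y t).1) (fun t => (y t).2.1) fun t => (y t).2.2 } with hd
  refine ⟨d, ?_⟩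
  rw [diamondCode_errorProb_eq W d (fun m u v z => ∑ y, V (ι₀ u + s₀) (ι₁ v + s₁) y *
    (if dec (c.dec y) (fun t => xor (x m t) (select z u v t)) z = m then 0 else 1)) (by
      rintro m u v z _ rfl
      rfl)]
  have hF (m u v z) : ∑ y, V (ι₀ u + s₀) (ι₁ v + s₁) y *
      (if dec (c.dec y) (fun t => xor (x m t) (select z u v t)) z = m then (0 : ℝ) else 1)
        ≤ e (ι₀ u + s₀) (ι₁ v + s₁) + E m z := by
    have h1 : E m z = ∑ y, V (ι₀ u + s₀) (ι₁ v + s₁) y * E m z := by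
      rw [← Finset.sum_mul, hVs, one_mul]
    rw [h1, he, ← Finset.sum_add_distrib]
    refine Finset.sum_le_sum fun y _ => ?_
    rw [← mul_add]
    refine mul_le_mul_of_nonneg_left ?_ (hV0 _ _ _)
    by_cases h : c.dec y = (ι₀ u + s₀, ι₁ v + s₁)
    · rw [if_pos h, zero_add, h]
      exact hdecE u v z m
    · rw [if_neg h]
      have : 0 ≤ E m z := by simp only [hE]; split_ifs <;> norm_num
      split_ifs <;> linarith
  set N : ℝ := 2 ^ n with hN
  have hNpos : 0 < N := by positivity
  have h8 : (1 / 8 : ℝ) ^ n = (N ^ 3)⁻¹ := by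
    rw [hN, ← pow_mul, mul_comm n 3, pow_mul, ← inv_pow]; norm_num
  calc _ ≤ (∑ m : Fin M, ∑ u : Fin n → Bool, ∑ v : Fin n → Bool, ∑ z : Fin n → Bool,
        (1 / 8 : ℝ) ^ n * (e (ι₀ u + s₀) (ι₁ v + s₁) + E m z)) / M := by
        gcongr with m _ u _ v _ z
        exact hF m u v z
    _ = (∑ a, ∑ b, e (ι₀ a + s₀) (ι₁ b + s₁)) / (N * N) + (∑ m, ∑ z, N⁻¹ * E m z) / M := by
        simp only [h8, mul_add, Finset.sum_add_distrib, ← Finset.mul_sum, Finset.sum_const,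
          Finset.card_univ, Fintype.card_fun, Fintype.card_bool, Fintype.card_fin, nsmul_eq_mul]
        push_cast
        rw [← hN]
        field_simp
    _ ≤ _ := by
        refine add_le_add (le_of_eq_of_le ?_ hs) hx
        simp [hN]

/-! ### Elementary bounds on the diamond capacity. -/

theorem diamond_errorProb_nonneg {𝒴 : Type*} [Fintype 𝒴] (W : Bool → Bool → PMF 𝒴) {n M K : ℕ}
    (c : DiamondCode Bool Bool Bool (Bool × Bool) Bool Bool (Bool × Bool) (𝒴 × (Bool × Bool))
      n M K) : 0 ≤ c.errorProb (diamondOfMAC W) := by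
  refine div_nonneg (Finset.sum_nonneg fun m _ => Finset.sum_nonneg fun _ _ =>
    Finset.sum_nonneg fun _ _ => Finset.sum_nonneg fun _ _ => mul_nonneg
    (Finset.prod_nonneg fun _ _ => ENNReal.toReal_nonneg) (Finset.sum_nonneg fun _ _ =>
      mul_nonneg (Finset.prod_nonneg fun _ _ => ENNReal.toReal_nonneg) ?_)) (by positivity)
  split_ifs <;> norm_num

/-- Everything after the source depends on the message only through its $n$-bit codeword, so
counting applies with all the network's randomness as the output. This bounds the capacity by $1$
whatever the cooperation rate. -/
theorem diamond_correct_le {𝒴 : Type*} [Fintype 𝒴] (W : Bool → Bool → PMF 𝒴) {n M K : ℕ}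
    (hM : 0 < M)
    (c : DiamondCode Bool Bool Bool (Bool × Bool) Bool Bool (Bool × Bool) (𝒴 × (Bool × Bool))
      n M K) : (1 - c.errorProb (diamondOfMAC W)) * M ≤ 2 ^ n := by
  have hM' : (0 : ℝ) < M := by exact_mod_cast hM
  set S : (Fin n → Bool) → (Fin n → Bool) → (Fin n → Bool) → (Fin n → Bool) → Fin n → Bool × Bool :=
    fun x u v z t => (xor (x t) (select z u v t), z t) with hS
  set P : (Fin n → Bool) → (Fin n → Bool) → (Fin n → Bool) → (Fin n → Bool) → (Fin n → 𝒴) → ℝ :=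
    fun x u v z y => ∏ t, (W (c.relay₀ u (c.cf u v (S x u v z)) t)
      (c.relay₁ v (c.cf u v (S x u v z)) t) (y t)).toReal with hP
  have hP0 (x u v z y) : 0 ≤ P x u v z y := prod_channel_nonneg (fun t => W _ _) y
  have hPs (x u v z) : ∑ y, P x u v z y = 1 := sum_prod_channel fun t =>
    W (c.relay₀ u (c.cf u v (S x u v z)) t) (c.relay₁ v (c.cf u v (S x u v z)) t)
  set g : (Fin n → Bool) → (Fin n → Bool) → (Fin n → Bool) → (Fin n → Bool) → (Fin n → 𝒴) → Fin M :=
    fun x u v z y => c.dec fun t => (y t, c.relay₂ (S x u v z) (c.cf u v (S x u v z)) t) with hg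
  have hc : ∑ _u : Fin n → Bool, ∑ _v : Fin n → Bool, ∑ _z : Fin n → Bool, (1 / 8 : ℝ) ^ n = 1 := by
    have h8 : (8 : ℝ) = 2 * 2 * 2 := by norm_num
    simp
    rw [h8, mul_pow, mul_pow]
    field_simp
  have key := sum_correct_le_card c.enc
    (V := fun x (i : (Fin n → Bool) × (Fin n → Bool) × (Fin n → Bool) × (Fin n → 𝒴)) =>
      (1 / 8) ^ n * P x i.1 i.2.1 i.2.2.1 i.2.2.2)
    (fun x i => mul_nonneg (by positivity) (hP0 _ _ _ _ _))
    (fun x => by simp only [Fintype.sum_prod_type, ← Finset.mul_sum, hPs]; exact Eq.trans (by simp; ring) hc)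
    (fun x i => g x i.1 i.2.1 i.2.2.1 i.2.2.2)
  rw [diamondCode_errorProb_eq W c (fun m u v z => ∑ y, P (c.enc m) u v z y *
    (if g (c.enc m) u v z y = m then 0 else 1)) (by rintro m u v z _ rfl; rfl)]
  have h1 (m u v z) : ∑ y, P (c.enc m) u v z y *
      (if g (c.enc m) u v z y = m then (0 : ℝ) else 1)
        = 1 - ∑ y, P (c.enc m) u v z y * (if g (c.enc m) u v z y = m then 1 else 0) := by
    rw [eq_sub_iff_add_eq, ← Finset.sum_add_distrib]
    refine Eq.trans (Finset.sum_congr rfl fun y _ => ?_) (hPs (c.enc m) u v z)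
    split_ifs <;> ring
  simp only [h1, mul_sub, Finset.sum_sub_distrib, mul_one, hc]
  simp only [Fintype.sum_prod_type, mul_assoc, ← Finset.mul_sum] at key
  simp only [← Finset.mul_sum, Finset.sum_const, Finset.card_univ, Fintype.card_fin, nsmul_eq_mul,
    mul_one]
  rw [sub_mul, div_mul_cancel₀ _ hM'.ne']
  have hcard : ((Fintype.card (Fin n → Bool) : ℕ) : ℝ) = 2 ^ n := by simp
  rw [hcard] at key
  linarith

theorem DiamondAchievable.le_one {𝒴 : Type*} [Fintype 𝒴] {W : Bool → Bool → PMF 𝒴} {κ R : ℝ}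
    (h : DiamondAchievable (diamondOfMAC W) κ R) : R ≤ 1 := by
  obtain ⟨h₀, c, hc⟩ := h
  refine rate_le_of_correct_le h₀ hc fun n => ?_
  rw [mul_one, Real.rpow_natCast]
  exact diamond_correct_le W (indexSize_pos n h₀) (c n)

theorem bddAbove_diamond {𝒴 : Type*} [Fintype 𝒴] (W : Bool → Bool → PMF 𝒴) (κ : ℝ) :
    BddAbove {R : ℝ | DiamondAchievable (diamondOfMAC W) κ R} :=
  ⟨1, fun _ h => h.le_one⟩

theorem DiamondAchievable.zero {𝒴 : Type*} [Fintype 𝒴] (W : Bool → Bool → PMF 𝒴) {κ : ℝ}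
    (hκ : 0 ≤ κ) : DiamondAchievable (diamondOfMAC W) κ 0 := by
  refine ⟨le_rfl, fun n => ⟨fun _ _ => false, fun _ _ _ => ⟨0, indexSize_pos n hκ⟩,
    fun _ _ _ => false, fun _ _ _ => false, fun _ _ _ => (false, false),
    fun _ => ⟨0, indexSize_pos n le_rfl⟩⟩, ?_⟩
  refine tendsto_const_nhds.congr fun n => ?_
  have (a b : Fin (indexSize n 0)) : a = b := by
    have := indexSize_zero_right n
    ext; omega
  rw [DiamondCode.errorProb, Finset.sum_eq_zero, zero_div]
  intro m _
  refine Finset.sum_eq_zero fun _ _ => Finset.sum_eq_zero fun _ _ => Finset.sum_eq_zero fun _ _ =>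
    mul_eq_zero_of_right _ (Finset.sum_eq_zero fun y _ => ?_)
  rw [if_pos (this _ _), mul_zero]

theorem diamondCapacity_nonneg {𝒴 : Type*} [Fintype 𝒴] (W : Bool → Bool → PMF 𝒴) {κ : ℝ}
    (hκ : 0 ≤ κ) : 0 ≤ diamondCapacity (diamondOfMAC W) κ :=
  le_csSup (bddAbove_diamond W κ) (DiamondAchievable.zero W hκ)

/-! ### Comparison of the two capacities. -/

theorem diamondAchievable_of_macAchievable {𝒴 : Type*} [Fintype 𝒴] {W : Bool → Bool → PMF 𝒴}
    {κ R₀ R₁ R : ℝ} (hκ : 0 ≤ κ) (h : MACAchievable W κ R₀ R₁) (hR : 0 ≤ R)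
    (hlt : R < (R₀ + R₁) / 2 - κ) : DiamondAchievable (diamondOfMAC W) κ R := by
  have hl : 0 < Real.log 2 := Real.log_pos (by norm_num)
  have b₀ := h.le₀
  have b₁ := h.le₁
  obtain ⟨h₀, h₁, c, hc⟩ := h
  -- One $\varepsilon$ is spent on the deviation $\tau=n\varepsilon$ of the number of known
  -- positions, the other on the exponent of the collision probability.
  obtain ⟨ε, hε, hRε⟩ : ∃ ε, 0 < ε ∧ R + 2 * ε = (R₀ + R₁) / 2 - κ :=
    ⟨((R₀ + R₁) / 2 - κ - R) / 2, by linarith, by ring⟩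
  have hk (n : ℕ) {r : ℝ} (hr0 : 0 ≤ r) (hr : r ≤ 1 + κ) :
      ∃ k ≤ n, 2 ^ k ≤ indexSize n r ∧ n * (r - κ) - 1 ≤ (k : ℝ) := by
    -- A relay holds only $n$ bits, hence the minimum. Since $r\le1+\kappa$, the cap costs at most
    -- $n\kappa$, and the floor at most $1$.
    refine ⟨min n ⌊n * r⌋₊, min_le_left _ _, ?_, ?_⟩
    · refine Nat.le_floor ?_
      push_cast
      rw [← Real.rpow_natCast]
      refine Real.rpow_le_rpow_of_exponent_le (by norm_num) ?_
      exact (Nat.cast_le.2 (min_le_right _ _)).trans (Nat.floor_le (by positivity))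
    · have hn : (0 : ℝ) ≤ n := n.cast_nonneg
      rw [Nat.cast_min]
      refine le_min (by nlinarith) ?_
      have := Nat.lt_floor_add_one (n * r)
      nlinarith
  have hex (n : ℕ) : ∃ d : DiamondCode Bool Bool Bool (Bool × Bool) Bool Bool (Bool × Bool)
      (𝒴 × (Bool × Bool)) n (indexSize n R) (indexSize n κ), 0 < n →
        d.errorProb (diamondOfMAC W) ≤ (c n).errorProb W +
          (1 / (n * ε ^ 2) + 2 * Real.exp (-(n * (ε * Real.log 2)))) := by
    obtain ⟨k₀, hk₀, hM₀, e₀⟩ := hk n h₀ b₀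
    obtain ⟨k₁, hk₁, hM₁, e₁⟩ := hk n h₁ b₁
    rcases Nat.eq_zero_or_pos n with rfl | hn
    · obtain ⟨d, -⟩ := exists_diamondCode W hk₀ hk₁ hM₀ hM₁ (indexSize_pos 0 hR) (c 0) one_pos
      exact ⟨d, fun h => absurd h (lt_irrefl 0)⟩
    have hn' : (0 : ℝ) < n := by exact_mod_cast hn
    obtain ⟨d, hd⟩ := exists_diamondCode W hk₀ hk₁ hM₀ hM₁ (indexSize_pos n hR) (c n)
      (τ := n * ε) (by positivity)
    refine ⟨d, fun _ => hd.trans (add_le_add le_rfl (add_le_add (le_of_eq (by field_simp)) ?_))⟩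
    calc _ ≤ Real.exp (n * R * Real.log 2) *
          Real.exp (-(Real.log 2 * ((k₀ + k₁ : ℝ) / 2 - n * ε))) := by
          gcongr
          rw [← two_rpow_eq_exp]
          exact indexSize_le n R
      _ ≤ Real.exp (Real.log 2) * Real.exp (-(n * (ε * Real.log 2))) := by
          rw [← Real.exp_add, ← Real.exp_add]
          refine Real.exp_le_exp.2 ?_
          -- The $+1$ averages the two floor losses and becomes the factor $2$ in the error bound.
          have : n * R + n * ε ≤ (k₀ + k₁ : ℝ) / 2 - n * ε + 1 := by
            have : n * (R + 2 * ε) = n * ((R₀ + R₁) / 2 - κ) := by rw [hRε]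
            nlinarith
          linarith [mul_le_mul_of_nonneg_right this hl.le]
      _ = _ := by rw [Real.exp_log (by norm_num)]
  choose d hd using hex
  refine ⟨hR, d, ?_⟩
  have hlim : Tendsto (fun n : ℕ => (c n).errorProb W +
      (1 / (n * ε ^ 2) + 2 * Real.exp (-(n * (ε * Real.log 2))))) atTop (𝓝 (0 + (0 + 2 * 0))) :=
    hc.add ((tendsto_const_nhds.div_atTop (tendsto_natCast_atTop_atTop.atTop_mul_const
      (by positivity))).add ((tendsto_exp_neg_natCast_mul (by positivity)).const_mul 2))
  rw [mul_zero, add_zero, add_zero] at hlim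
  exact squeeze_zero' (Eventually.of_forall fun n => diamond_errorProb_nonneg W (d n))
    ((eventually_gt_atTop 0).mono fun n hn => hd n hn) hlim

theorem macSumCapacity_le {𝒴 : Type*} [Fintype 𝒴] (W : Bool → Bool → PMF 𝒴) {κ : ℝ} (hκ : 0 ≤ κ) :
    macSumCapacity W κ ≤ 2 * diamondCapacity (diamondOfMAC W) κ + 2 * κ := by
  refine csSup_le ⟨_, 0, 0, MACAchievable.zero W hκ, rfl⟩ ?_
  rintro _ ⟨R₀, R₁, h, rfl⟩
  suffices (R₀ + R₁) / 2 - κ ≤ diamondCapacity (diamondOfMAC W) κ by linarith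
  refine le_of_forall_lt fun R hR => ?_
  obtain ⟨R', h1, h2⟩ := exists_between hR
  -- Achievable rates are nonnegative by definition, so a negative target is handled by the
  -- nonnegativity of the capacity.
  rcases lt_or_ge R' 0 with h0 | h0
  · exact (h1.trans h0).trans_le (diamondCapacity_nonneg W hκ)
  · exact h1.trans_le (le_csSup (bddAbove_diamond W κ)
      (diamondAchievable_of_macAchievable hκ h h0 h2))

theorem two_mul_diamondCapacity_zero_le {𝒴 : Type*} [Fintype 𝒴] (W : Bool → Bool → PMF 𝒴) :
    2 * diamondCapacity (diamondOfMAC W) 0 ≤ macSumCapacity W 0 := by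
  have hl : 0 < Real.log 2 := Real.log_pos (by norm_num)
  suffices diamondCapacity (diamondOfMAC W) 0 ≤ macSumCapacity W 0 / 2 by linarith
  refine csSup_le ⟨0, DiamondAchievable.zero W le_rfl⟩ ?_
  rintro R ⟨hR, c, hc⟩
  set C := macSumCapacity W 0 with hC
  -- The $n$-letter converse divided by $n\log2$. The left $1/n$ comes from the floor in the number
  -- of messages, the right one from Fano's $\log2$.
  have hb : ∀ᶠ n : ℕ in atTop, (1 - (c n).errorProb (diamondOfMAC W)) * (R - 1 / n)
      ≤ 1 / n + C / 2 := by
    filter_upwards [eventually_gt_atTop 0, hc.eventually_le_const (one_pos)] with n hn he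
    have hn' : (0 : ℝ) < n := by exact_mod_cast hn
    have hM : (0 : ℝ) < indexSize n R := by exact_mod_cast indexSize_pos n hR
    have : Subsingleton (Fin (indexSize n 0)) := by rw [indexSize_zero_right]; infer_instance
    have h1 := diamond_correct_mul_log_le W (indexSize_pos n hR) (c n)
    have h2 : n * R * Real.log 2 - Real.log 2 ≤ Real.log (indexSize n R) := by
      have h3 := Real.log_le_log (by positivity) (rpow_le_two_mul_indexSize n hR)
      rw [Real.log_mul (by norm_num) hM.ne', Real.log_rpow (by norm_num)] at h3
      linarith
    have h3 := (mul_le_mul_of_nonneg_left h2 (sub_nonneg.2 he)).trans h1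
    have h4 : 0 < n * Real.log 2 := by positivity
    refine le_of_mul_le_mul_right ?_ h4
    have e1 : (1 - (c n).errorProb (diamondOfMAC W)) * (R - 1 / n) * (n * Real.log 2)
        = (1 - (c n).errorProb (diamondOfMAC W)) * (n * R * Real.log 2 - Real.log 2) := by
      field_simp
    have e2 : (1 / n + C / 2) * (n * Real.log 2) = Real.log 2 + n * (C * Real.log 2) / 2 := by
      field_simp
    rw [e1, e2]
    exact h3
  have hn0 : Tendsto (fun n : ℕ => (1 : ℝ) / n) atTop (𝓝 0) := tendsto_one_div_atTop_nhds_zero_nat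
  have hL := (hc.const_sub 1).mul (hn0.const_sub R)
  have hU := hn0.add_const (C / 2)
  simpa using le_of_tendsto_of_tendsto hL hU hb

end

theorem claim1 {𝒴W : Type*} [Fintype 𝒴W] (W : Bool → Bool → PMF 𝒴W)
    (hW : HasInfiniteSlopeAtZero (macSumCapacity W)) :
    HasInfiniteSlopeAtZero (diamondCapacity (diamondOfMAC W)) := by
  unfold HasInfiniteSlopeAtZero at *
  -- The shift by $-2$ absorbs the term $2\delta$ of `macSumCapacity_le`, and the division by $2$
  -- its factor $2$.
  have h := (tendsto_atTop_add_const_right _ (-2) hW).atTop_div_const (two_pos : (0 : ℝ) < 2)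
  refine tendsto_atTop_mono' _ ?_ h
  filter_upwards [self_mem_nhdsWithin] with δ hδ
  have hδ' : 0 < δ := hδ
  have h1 := macSumCapacity_le W hδ'.le
  have h0 := two_mul_diamondCapacity_zero_le W
  rw [le_div_iff₀ hδ', div_mul_eq_mul_div, add_mul, div_mul_cancel₀ _ hδ'.ne']
  linarith
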